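/- **Setting.** Consider $N$ spins-1/2 on a chain with sites $1,\dots,N$, and let $\|\cdot\|$ be the operator norm. Fix $\xi>0$ and $q$. A unitary $U$ is *quasilocal* (with parameters $\xi,q$) if $$U=\prod_{n=1}^{N}\prod_{j=1}^{n}\prod_{i=0}^{\lfloor (N-n)/n\rfloor}U^{(n)}_{in+j},$$ with the factors multiplied with the indices increasing either from left to right or from right to left, where $U^{(n)}_k$ is a unitary acting on sites $k,\dots,k+n-1$ (if $k+n-1>N$: a tensor product of a unitary on sites $k,\dots,N$ and a unitary on sites $1,\dots,k+n-1-N$) with $\|\mathbb 1-U^{(n)}_k\|^2<q\,e^{-(n-1)/\xi}$. A Hamiltonian $H$ is *MBL* (with localization length $\xi$ and constant $q$) if, for some such $U$ and $\tau^z_i=U\sigma^z_iU^\dagger$, $$H=\sum_{p\ge1}\ \sum_{i_1<\dots<i_p}J_{i_1\dots i_p}\,\tau^z_{i_1}\cdots\tau^z_{i_p},\qquad J_{i_1\dots i_p}\in\mathbb R,\quad |J_{i_1\dots i_p}|\le e^{-(i_p-i_1)/\xi}.$$ The *$\epsilon$-approximate circuit complexity* $C_\epsilon(W)$ is the least $k$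 such that $\|G_k\cdots G_1-W\|\le\epsilon$ for some gates $G_1,\dots,G_k$, each a $\mathrm{CNOT}$, a Hadamard gate or a $T=\mathrm{diag}(1,e^{i\pi/4})$ gate applied to some of the $N$ qubits (no ancillas). **Theorem 3 (Sublinear growth of MBL circuit complexity).** Let $0<\xi<1/(4\log 2)$, let $q\in\mathbb R$ and let $\epsilon>0$ be constants. Then there are real polynomials $P,Q$ and a function $g$ with $g(t)=o(t)$ as $t\to\infty$, depending only on $\xi,q,\epsilon$, such that for every $N\ge1$, every MBL Hamiltonian $H$ on $N$ sites with localization length $\xi$ and constant $q$, and every $t>0$, some circuit over $\{\mathrm{CNOT},\mathrm H,T\}$ approximates $e^{-iHt}$ up to error $\epsilon$ and $$C_\epsilon(e^{-iHt})\ \le\ P(N)\,Q(\log(N^2t))\,g(t).$$ Moreover, for each fixed $N$ the right-hand side is $o(t)$ as $t\to\infty$; in particular, the complexity grows sublinearly in $t$. -/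

import Mathlib

open scoped Matrix.Norms.L2Operator

namespace MBL

/-- Computational basis of `N` spins-1/2; `x i = 0` is spin up (`σᶻ = +1`) at site `i`. -/
abbrev Basis (N : ℕ) : Type := Fin N → Fin 2

/-- Operators on the `N`-spin Hilbert space, as matrices in the computational basis.
The norm on these matrices is the (ℓ²) operator norm, i.e. the largest singular value. -/
abbrev Op (N : ℕ) : Type := Matrix (Basis N) (Basis N) ℂ

/-- The Pauli operator `σᶻ` at site `i`. -/
def sigmaZ {N : ℕ} (i : Fin N) : Op N :=
  Matrix.diagonal fun x => if x i = 0 then 1 else -1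

/-- `A` acts on the sites in `S`: it is `B ⊗ 𝟙` for an operator `B` on the spins in `S`. -/
def ActsOn {N : ℕ} (S : Finset (Fin N)) (A : Op N) : Prop :=
  ∃ B : Matrix (S → Fin 2) (S → Fin 2) ℂ, ∀ x y : Basis N,
    A x y = if ∀ i, i ∉ S → x i = y i then B (fun i => x i) (fun i => y i) else 0

/-- The sites `a, a + 1, …, b` of the chain, where sites are numbered `1, …, N`
(site number `s` is the index `s - 1` of `Fin N`). -/
def sites (N a b : ℕ) : Finset (Fin N) :=
  Finset.univ.filter fun s => a ≤ s.val + 1 ∧ s.val + 1 ≤ b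

/-- `V` is an admissible constituent `U_k^{(n)}`: a unitary acting on sites
`k, …, k + n - 1`; if this range exceeds the chain, a tensor product of a unitary on sites
`k, …, N` and a unitary on sites `1, …, k + n - 1 - N`. Moreover it is close to the identity. -/
def IsConstituent {N : ℕ} (ξ q : ℝ) (n k : ℕ) (V : Op N) : Prop :=
  ((k + n - 1 ≤ N ∧ V ∈ Matrix.unitaryGroup (Basis N) ℂ ∧ ActsOn (sites N k (k + n - 1)) V) ∨
    (N < k + n - 1 ∧ ∃ A B : Op N,
      A ∈ Matrix.unitaryGroup (Basis N) ℂ ∧ ActsOn (sites N k N) A ∧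
      B ∈ Matrix.unitaryGroup (Basis N) ℂ ∧ ActsOn (sites N 1 (k + n - 1 - N)) B ∧
      V = A * B)) ∧
  ‖(1 : Op N) - V‖ ^ 2 < q * Real.exp (-((n : ℝ) - 1) / ξ)

/-- The factors `V n (i * n + j)`, listed in the order of the nested product
over `n = 1, …, N`, then `j = 1, …, n`, then `i = 0, …, ⌊(N - n) / n⌋`. -/
def factors {N : ℕ} (V : ℕ → ℕ → Op N) : List (Op N) :=
  (List.range' 1 N).flatMap fun n =>
    (List.range' 1 n).flatMap fun j =>
      (List.range ((N - n) / n + 1)).map fun i => V n (i * n + j)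

/-- Quasilocal unitaries on a chain of `N` sites, with localization length `ξ` and constant `q`.
The product sign for noncommuting factors is read in either of the two usual ways
(indices increasing from left to right, or from right to left); both are admitted. -/
def IsQuasilocal {N : ℕ} (ξ q : ℝ) (U : Op N) : Prop :=
  ∃ V : ℕ → ℕ → Op N,
    (∀ n j i : ℕ, 1 ≤ n → n ≤ N → 1 ≤ j → j ≤ n → i ≤ (N - n) / n →
      IsConstituent ξ q n (i * n + j) (V n (i * n + j))) ∧
    (U = (factors V).prod ∨ U = (factors V).reverse.prod)

/-- The local integral of motion `τᶻ_i = U σᶻ_i U†`. -/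
def tauZ {N : ℕ} (U : Op N) (i : Fin N) : Op N :=
  U * sigmaZ i * U.conjTranspose

/-- The product `τᶻ_{i₁} ⋯ τᶻ_{i_p}` for `I = {i₁ < ⋯ < i_p}`. -/
def tauProd {N : ℕ} (U : Op N) (I : Finset (Fin N)) : Op N :=
  ((I.sort (· ≤ ·)).map (tauZ U)).prod

/-- `H` is an MBL Hamiltonian with localization length `ξ` and constant `q`:
`H = ∑_I J_I τᶻ_I` over nonempty sets `I` of sites, with real couplings satisfying
`|J_{i₁…i_p}| ≤ exp (-(i_p - i₁) / ξ)` and with `τᶻ_i = U σᶻ_i U†`, `U` quasilocal. -/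
def IsMBL {N : ℕ} (ξ q : ℝ) (H : Op N) : Prop :=
  ∃ (U : Op N) (J : Finset (Fin N) → ℝ),
    IsQuasilocal ξ q U ∧
    (∀ (I : Finset (Fin N)) (hI : I.Nonempty),
      |J I| ≤ Real.exp (-(((I.max' hI).val : ℝ) - ((I.min' hI).val : ℝ)) / ξ)) ∧
    H = ∑ I ∈ Finset.univ.filter (fun I : Finset (Fin N) => I.Nonempty),
      (J I : ℂ) • tauProd U I

/-- The gates Hadamard, `T` and `CNOT` placed on a register of `N` qubits. -/
inductive Gate (N : ℕ) : Type
  | hadamard (i : Fin N) : Gate N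
  | phaseT (i : Fin N) : Gate N
  | cnot (control target : Fin N) (hne : control ≠ target) : Gate N

/-- The one-qubit operator `g` applied to qubit `i`. -/
def onQubit {N : ℕ} (i : Fin N) (g : Matrix (Fin 2) (Fin 2) ℂ) : Op N :=
  Matrix.of fun x y => if ∀ j, j ≠ i → x j = y j then g (x i) (y i) else 0

/-- The Hadamard matrix. -/
noncomputable def hadamardMatrix : Matrix (Fin 2) (Fin 2) ℂ :=
  (((Real.sqrt 2)⁻¹ : ℝ) : ℂ) • !![1, 1; 1, -1]

/-- The `π/8`-phase gate `T = diag(1, e^{iπ/4})`. -/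
noncomputable def tMatrix : Matrix (Fin 2) (Fin 2) ℂ :=
  !![1, 0; 0, Complex.exp (Complex.I * (Real.pi / 4 : ℝ))]

/-- The unitary implemented by a gate. -/
noncomputable def Gate.toOp {N : ℕ} : Gate N → Op N
  | .hadamard i => onQubit i hadamardMatrix
  | .phaseT i => onQubit i tMatrix
  | .cnot c t _ =>
      Matrix.of fun x y => if x = Function.update y t (y t + y c) then 1 else 0

/-- The unitary `G_k ⋯ G_2 G_1` of the circuit `[G_1, G_2, …, G_k]`. -/
noncomputable def circuitOp {N : ℕ} (G : List (Gate N)) : Op N :=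
  (G.map Gate.toOp).reverse.prod

/-- The sizes of the circuits that approximate `W` up to error `ε` in operator norm. -/
def approxSizes {N : ℕ} (ε : ℝ) (W : Op N) : Set ℕ :=
  {k | ∃ G : List (Gate N), G.length = k ∧ ‖circuitOp G - W‖ ≤ ε}

/-- The `ε`-approximate circuit complexity `C_ε(W)`, the least element of `approxSizes ε W`
(meaningful when that set is nonempty). -/
noncomputable def circuitComplexity {N : ℕ} (ε : ℝ) (W : Op N) : ℕ :=
  sInf (approxSizes ε W)

/-- The time evolution operator `e^{-iHt}`. -/
noncomputable def evolution {N : ℕ} (H : Op N) (t : ℝ) : Op N :=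
  NormedSpace.exp ((-(Complex.I * (t : ℂ))) • H)

end MBL

/-!
Write `H = U D U†` with `D = ∑ J_I ∏_{i ∈ I} σᶻ_i` diagonal, so that
`exp (-iHt) = U exp (-iDt) U†`.

The unitary `U` costs `poly(N)` gates, independently of `t`. Its constituents on more than
`O(log N)` sites are so close to `𝟙` that they can be dropped. Any other one is, up to a phase, the
exponential of a sum of `poly(N)` Pauli strings, which Trotter's formula splits into exponentials of
single Pauli strings. The phases cancel between `U` and `U†`.

Dropping from `D` the terms of width at least `r` costs an error `O(t N (2 e^{-1/ξ})^r)`, so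
`r ≈ log(tN) / (1/ξ - log 2)` suffices. What is left are at most `N 2^r` commuting factors
`exp (iθ ∏_{i ∈ I} σᶻ_i)`, each of which is conjugate by `CNOT`s to a one-qubit rotation.
Commutators of small rotations, as in the Solovay–Kitaev theorem, approximate the latter up to `δ`
by `O(δ ^ (-s))` gates, for any `s > 0`. The total `(N 2^r)^{1+s}` grows in `t` with the exponent
`(1 + s) log 2 / (1/ξ - log 2)`, which is less than `1` for small `s` as soon as `2 ξ log 2 < 1`.
-/

open scoped Quaternion

namespace MBL

section Commutator

variable {A : Type*} [NormedRing A]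

theorem norm_lie_le_two_mul (x y : A) : ‖⁅x, y⁆‖ ≤ 2 * (‖x‖ * ‖y‖) := by
  rw [Ring.lie_def]
  calc ‖x * y - y * x‖ ≤ ‖x * y‖ + ‖y * x‖ := norm_sub_le _ _
    _ ≤ ‖x‖ * ‖y‖ + ‖y‖ * ‖x‖ := add_le_add (norm_mul_le _ _) (norm_mul_le _ _)
    _ = 2 * (‖x‖ * ‖y‖) := by ring

theorem lie_sub_one_sub_one (x y : A) : ⁅x - 1, y - 1⁆ = ⁅x, y⁆ := by
  simp only [Ring.lie_def]
  noncomm_ring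

theorem norm_lie_sub_lie_le {a b a' b' : A} {η ρ : ℝ} (ha : ‖a - 1‖ ≤ ρ) (hb : ‖b - 1‖ ≤ ρ)
    (haa : ‖a' - a‖ ≤ η) (hbb : ‖b' - b‖ ≤ η) :
    ‖⁅a', b'⁆ - ⁅a, b⁆‖ ≤ 4 * η * ρ + 2 * η ^ 2 := by
  have hρ : 0 ≤ ρ := (norm_nonneg _).trans ha
  have hη : 0 ≤ η := (norm_nonneg _).trans haa
  have hb' : ‖b' - 1‖ ≤ η + ρ :=
    (norm_sub_le_norm_sub_add_norm_sub b' b 1).trans (add_le_add hbb hb)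
  have hsplit : ⁅a', b'⁆ - ⁅a, b⁆ = ⁅a' - a, b' - 1⁆ + ⁅a - 1, b' - b⁆ := by
    simp only [Ring.lie_def]
    noncomm_ring
  calc ‖⁅a', b'⁆ - ⁅a, b⁆‖
      ≤ ‖⁅a' - a, b' - 1⁆‖ + ‖⁅a - 1, b' - b⁆‖ := hsplit ▸ norm_add_le _ _
    _ ≤ 2 * (‖a' - a‖ * ‖b' - 1‖) + 2 * (‖a - 1‖ * ‖b' - b‖) :=
        add_le_add (norm_lie_le_two_mul _ _) (norm_lie_le_two_mul _ _)
    _ ≤ 2 * (η * (η + ρ)) + 2 * (ρ * η) := by gcongr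
    _ = 4 * η * ρ + 2 * η ^ 2 := by ring

variable [StarRing A]

theorem mul_mul_star_mul_star_eq {a b : A} (ha : a ∈ unitary A) (hb : b ∈ unitary A) :
    a * b * star a * star b = 1 + ⁅a, b⁆ * (star a * star b) := by
  have h : b * a * (star a * star b) = 1 := by
    rw [← star_mul, Unitary.mul_star_self_of_mem (mul_mem hb ha)]
  rw [Ring.lie_def, sub_mul, h]
  noncomm_ring

variable [CStarRing A]

theorem norm_mul_mul_star_sub_one {p : A} (hp : p ∈ unitary A) (x : A) :
    ‖p * x * star p - 1‖ = ‖x - 1‖ := by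
  have h : p * x * star p - 1 = p * (x - 1) * star p := by
    rw [mul_sub, sub_mul, mul_one, Unitary.mul_star_self_of_mem hp]
  rw [h, CStarRing.norm_mul_mem_unitary _ (Unitary.star_mem hp),
    CStarRing.norm_mem_unitary_mul _ hp]

theorem norm_star_mul_star_sub_le {a b a' b' : A} (ha : a ∈ unitary A) (hb' : b' ∈ unitary A)
    {η : ℝ} (haa : ‖a' - a‖ ≤ η) (hbb : ‖b' - b‖ ≤ η) :
    ‖star a' * star b' - star a * star b‖ ≤ 2 * η := by
  have hsplit : star a' * star b' - star a * star b =
      star (a' - a) * star b' + star a * star (b' - b) := by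
    simp only [star_sub]
    noncomm_ring
  calc ‖star a' * star b' - star a * star b‖
      ≤ ‖star (a' - a) * star b'‖ + ‖star a * star (b' - b)‖ := hsplit ▸ norm_add_le _ _
    _ = ‖a' - a‖ + ‖b' - b‖ := by
        rw [CStarRing.norm_mul_mem_unitary _ (Unitary.star_mem hb'),
          CStarRing.norm_mem_unitary_mul _ (Unitary.star_mem ha), norm_star, norm_star]
    _ ≤ 2 * η := by linarith

/-- The error is of second order because `⁅a, b⁆` only sees `a - 1` and `b - 1`. -/
theorem norm_groupCommutator_sub_le {a b a' b' : A} (ha : a ∈ unitary A) (hb : b ∈ unitary A)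
    (ha' : a' ∈ unitary A) (hb' : b' ∈ unitary A) {η ρ : ℝ} (ha1 : ‖a - 1‖ ≤ ρ)
    (hb1 : ‖b - 1‖ ≤ ρ) (haa : ‖a' - a‖ ≤ η) (hbb : ‖b' - b‖ ≤ η) :
    ‖a' * b' * star a' * star b' - a * b * star a * star b‖ ≤
      4 * ρ ^ 2 * η + 4 * η * ρ + 2 * η ^ 2 := by
  have hρ : 0 ≤ ρ := (norm_nonneg _).trans ha1
  have hlie : ‖⁅a, b⁆‖ ≤ 2 * (ρ * ρ) := by
    rw [← lie_sub_one_sub_one]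
    refine (norm_lie_le_two_mul _ _).trans ?_
    gcongr
  have hsplit : a' * b' * star a' * star b' - a * b * star a * star b =
      (⁅a', b'⁆ - ⁅a, b⁆) * (star a' * star b') +
        ⁅a, b⁆ * (star a' * star b' - star a * star b) := by
    rw [mul_mul_star_mul_star_eq ha' hb', mul_mul_star_mul_star_eq ha hb]
    noncomm_ring
  calc ‖a' * b' * star a' * star b' - a * b * star a * star b‖
      ≤ ‖(⁅a', b'⁆ - ⁅a, b⁆) * (star a' * star b')‖ +
          ‖⁅a, b⁆ * (star a' * star b' - star a * star b)‖ := hsplit ▸ norm_add_le _ _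
    _ ≤ ‖⁅a', b'⁆ - ⁅a, b⁆‖ + ‖⁅a, b⁆‖ * ‖star a' * star b' - star a * star b‖ := by
        rw [CStarRing.norm_mul_mem_unitary _
          (mul_mem (Unitary.star_mem ha') (Unitary.star_mem hb'))]
        gcongr
        exact norm_mul_le _ _
    _ ≤ (4 * η * ρ + 2 * η ^ 2) + 2 * (ρ * ρ) * (2 * η) := by
        gcongr
        · exact norm_lie_sub_lie_le ha1 hb1 haa hbb
        · exact norm_star_mul_star_sub_le ha hb' haa hbb
    _ = 4 * ρ ^ 2 * η + 4 * η * ρ + 2 * η ^ 2 := by ring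

end Commutator

section UnitQuaternion

/-- The quaternion `a + b i + c j + d k`, typed so that the simp lemmas on `Quaternion` fire. -/
def quat (a b c d : ℝ) : ℍ[ℝ] := ⟨a, b, c, d⟩

@[simp] theorem quat_re (a b c d : ℝ) : (quat a b c d).re = a := rfl
@[simp] theorem quat_imI (a b c d : ℝ) : (quat a b c d).imI = b := rfl
@[simp] theorem quat_imJ (a b c d : ℝ) : (quat a b c d).imJ = c := rfl
@[simp] theorem quat_imK (a b c d : ℝ) : (quat a b c d).imK = d := rfl

theorem quaternion_norm_sq (q : ℍ[ℝ]) :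
    ‖q‖ ^ 2 = q.re ^ 2 + q.imI ^ 2 + q.imJ ^ 2 + q.imK ^ 2 := by
  rw [sq, ← Quaternion.normSq_eq_norm_mul_self, Quaternion.normSq_def']

theorem quaternion_norm_sq_eq_re_add_im (q : ℍ[ℝ]) : ‖q‖ ^ 2 = q.re ^ 2 + ‖q.im‖ ^ 2 := by
  simp only [quaternion_norm_sq, Quaternion.re_im, Quaternion.imI_im, Quaternion.imJ_im,
    Quaternion.imK_im]
  ring

theorem mem_unitary_quaternion_iff {q : ℍ[ℝ]} : q ∈ unitary ℍ[ℝ] ↔ ‖q‖ = 1 := by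
  refine ⟨CStarRing.norm_of_mem_unitary, fun h => ?_⟩
  rw [Unitary.mem_iff, Quaternion.star_mul_self, Quaternion.self_mul_star,
    Quaternion.normSq_eq_norm_mul_self, h]
  simp

theorem mem_unitary_quaternion_of_sum_sq {q : ℍ[ℝ]}
    (h : q.re ^ 2 + q.imI ^ 2 + q.imJ ^ 2 + q.imK ^ 2 = 1) : q ∈ unitary ℍ[ℝ] := by
  rw [← quaternion_norm_sq] at h
  exact mem_unitary_quaternion_iff.2 ((pow_eq_one_iff_of_nonneg (norm_nonneg _) two_ne_zero).1 h)

theorem norm_inv_smul_mem_unitary {p : ℍ[ℝ]} (hp : p ≠ 0) : ‖p‖⁻¹ • p ∈ unitary ℍ[ℝ] := by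
  rw [mem_unitary_quaternion_iff, norm_smul, norm_inv, norm_norm,
    inv_mul_cancel₀ (norm_ne_zero_iff.2 hp)]

theorem norm_sub_one_sq_of_mem_unitary {q : ℍ[ℝ]} (h : q ∈ unitary ℍ[ℝ]) :
    ‖q - 1‖ ^ 2 = 2 * (1 - q.re) := by
  have h1 := quaternion_norm_sq q
  rw [CStarRing.norm_of_mem_unitary h] at h1
  rw [quaternion_norm_sq]
  simp only [Quaternion.re_sub, Quaternion.imI_sub, Quaternion.imJ_sub, Quaternion.imK_sub,
    Quaternion.re_one, Quaternion.imI_one, Quaternion.imJ_one, Quaternion.imK_one]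
  linarith

theorem eq_neg_of_forall_mul_add_mul_eq_zero {a b : ℍ[ℝ]}
    (h : ∀ y, a * y + y * b = 0) : a = -b ∧ a.im = 0 := by
  have h1 := h 1
  have hab : a = -b := by simpa [add_eq_zero_iff_eq_neg] using h1
  refine ⟨hab, ?_⟩
  have hi := h (quat 0 1 0 0)
  have hj := h (quat 0 0 1 0)
  rw [hab] at hi hj ⊢
  simp only [Quaternion.ext_iff] at hi hj
  simp at hi hj
  ext <;> simp <;> linarith

/-- `a² = b² = -‖a‖²` is central, so every `a y + y b` intertwines `a` and `b`. -/
theorem exists_intertwiner_of_re_eq_zero {a b : ℍ[ℝ]} (ha : a.re = 0) (hb : b.re = 0)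
    (hn : ‖a‖ = ‖b‖) : ∃ p : ℍ[ℝ], p ≠ 0 ∧ a * p = p * b := by
  by_cases h : ∀ y, a * y + y * b = 0
  · obtain ⟨hab, him⟩ := eq_neg_of_forall_mul_add_mul_eq_zero h
    have h0 : a = 0 := by rw [← Quaternion.re_add_im a, ha, him]; simp
    have hb0 : b = 0 := by rw [← neg_eq_zero, ← hab, h0]
    exact ⟨1, one_ne_zero, by rw [h0, hb0]; simp⟩
  · push Not at h
    obtain ⟨y, hy⟩ := h
    refine ⟨_, hy, ?_⟩
    have hsq : a * a * y = y * (b * b) := by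
      rw [← sq, ← sq, Quaternion.sq_eq_neg_normSq.2 ha, Quaternion.sq_eq_neg_normSq.2 hb,
        Quaternion.normSq_eq_norm_mul_self, Quaternion.normSq_eq_norm_mul_self, hn, neg_mul,
        mul_neg, Quaternion.coe_commutes]
    calc a * (a * y + y * b) = a * a * y + a * y * b := by noncomm_ring
      _ = (a * y + y * b) * b := by rw [hsq]; noncomm_ring

theorem exists_conj_of_re_eq {q r : ℍ[ℝ]} (hre : q.re = r.re) (hn : ‖q‖ = ‖r‖) :
    ∃ p ∈ unitary ℍ[ℝ], r = p * q * star p := by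
  have him : ‖r.im‖ = ‖q.im‖ := by
    have hq := quaternion_norm_sq_eq_re_add_im q
    have hr := quaternion_norm_sq_eq_re_add_im r
    rw [hn, hre] at hq
    exact (sq_eq_sq₀ (norm_nonneg _) (norm_nonneg _)).1 (by linarith)
  obtain ⟨p, hp, h⟩ :=
    exists_intertwiner_of_re_eq_zero (Quaternion.re_im r) (Quaternion.re_im q) him
  have hrp : r * p = p * q := by
    rw [← Quaternion.re_add_im r, ← Quaternion.re_add_im q, add_mul, mul_add, h, hre,
      Quaternion.coe_commutes]
  have hu := norm_inv_smul_mem_unitary hp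
  refine ⟨_, hu, ?_⟩
  rw [smul_mul_assoc, ← hrp, ← mul_smul_comm, mul_assoc, Unitary.mul_star_self_of_mem hu, mul_one]

theorem re_groupCommutator_quat {c s : ℝ} (h : c ^ 2 + s ^ 2 = 1) :
    (quat c s 0 0 * quat c 0 s 0 * star (quat c s 0 0) * star (quat c 0 s 0)).re =
      1 - 2 * s ^ 4 := by
  simp
  linear_combination (c ^ 2 + 1 + s ^ 2) * h

/-- The rotations `c + s i` and `c + s j` with `s² = ‖w - 1‖ / 2` have a commutator conjugate
to `w`. -/
theorem exists_balanced_commutator {w : ℍ[ℝ]} (hw : w ∈ unitary ℍ[ℝ]) :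
    ∃ a ∈ unitary ℍ[ℝ], ∃ b ∈ unitary ℍ[ℝ], ‖a - 1‖ ^ 2 ≤ ‖w - 1‖ ∧ ‖b - 1‖ ^ 2 ≤ ‖w - 1‖ ∧
      a * b * star a * star b = w := by
  have hle : ‖w - 1‖ ≤ 2 := by
    calc ‖w - 1‖ ≤ ‖w‖ + ‖(1 : ℍ[ℝ])‖ := norm_sub_le _ _
      _ = 2 := by rw [CStarRing.norm_of_mem_unitary hw, norm_one]; norm_num
  obtain ⟨s, hs⟩ : ∃ s : ℝ, s ^ 2 = ‖w - 1‖ / 2 := ⟨_, Real.sq_sqrt (by positivity)⟩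
  obtain ⟨c, hc0, hc⟩ : ∃ c : ℝ, 0 ≤ c ∧ c ^ 2 = 1 - s ^ 2 :=
    ⟨_, Real.sqrt_nonneg _, Real.sq_sqrt (by linarith)⟩
  have hc1 : 2 * (1 - c) ≤ ‖w - 1‖ := by nlinarith [sq_nonneg s]
  have ha : quat c s 0 0 ∈ unitary ℍ[ℝ] := mem_unitary_quaternion_of_sum_sq (by simp [hc])
  have hb : quat c 0 s 0 ∈ unitary ℍ[ℝ] := mem_unitary_quaternion_of_sum_sq (by simp [hc])
  have hab := mul_mem (mul_mem (mul_mem ha hb) (Unitary.star_mem ha)) (Unitary.star_mem hb)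
  have hre : (quat c s 0 0 * quat c 0 s 0 * star (quat c s 0 0) * star (quat c 0 s 0)).re
      = w.re := by
    rw [re_groupCommutator_quat (by linarith), show s ^ 4 = (s ^ 2) ^ 2 by ring, hs]
    linarith [norm_sub_one_sq_of_mem_unitary hw]
  obtain ⟨p, hp, rfl⟩ := exists_conj_of_re_eq hre
    (by rw [CStarRing.norm_of_mem_unitary hab, CStarRing.norm_of_mem_unitary hw])
  have hpp := Unitary.star_mem hp
  refine ⟨p * quat c s 0 0 * star p, mul_mem (mul_mem hp ha) hpp,
    p * quat c 0 s 0 * star p, mul_mem (mul_mem hp hb) hpp, ?_, ?_, ?_⟩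
  · rwa [norm_mul_mul_star_sub_one hp, norm_sub_one_sq_of_mem_unitary ha, quat_re]
  · rwa [norm_mul_mul_star_sub_one hp, norm_sub_one_sq_of_mem_unitary hb, quat_re]
  · simp only [← Unitary.conjStarAlgAut_apply (S := ℝ) ⟨p, hp⟩, ← map_star, ← map_mul]

end UnitQuaternion

section SolovayKitaev

/-- `Γ n` models the unitaries given by words of length at most `n` over a gate set in which
inverting a word lengthens it by a factor of at most `κ`. -/
structure IsWordFiltration (κ : ℕ) (Γ : ℕ → Set ℍ[ℝ]) : Prop where
  mono : Monotone Γ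
  subset_unitary : ∀ n, Γ n ⊆ unitary ℍ[ℝ]
  mul_mem : ∀ {m n a b}, a ∈ Γ m → b ∈ Γ n → a * b ∈ Γ (m + n)
  star_mem : ∀ {n a}, a ∈ Γ n → star a ∈ Γ (κ * n)

/-- Every unit quaternion is within `δ` of `S`. -/
def IsUnitNet (δ : ℝ) (S : Set ℍ[ℝ]) : Prop := ∀ q ∈ unitary ℍ[ℝ], ∃ a ∈ S, ‖a - q‖ ≤ δ

variable {κ : ℕ} {Γ : ℕ → Set ℍ[ℝ]}

theorem exists_isUnitNet (hmono : Monotone Γ)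
    (hdense : (unitary ℍ[ℝ] : Set ℍ[ℝ]) ⊆ closure (⋃ n, Γ n)) {δ : ℝ} (hδ : 0 < δ) :
    ∃ n, IsUnitNet δ (Γ n) := by
  have hunit : (unitary ℍ[ℝ] : Set ℍ[ℝ]) = Metric.sphere 0 1 := by
    ext q
    simp [mem_unitary_quaternion_iff]
  have hcover : (unitary ℍ[ℝ] : Set ℍ[ℝ]) ⊆ ⋃ n, ⋃ a ∈ Γ n, Metric.ball a δ := by
    intro q hq
    obtain ⟨a, ha, hqa⟩ := Metric.mem_closure_iff.1 (hdense hq) δ hδ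
    obtain ⟨n, hn⟩ := Set.mem_iUnion.1 ha
    exact Set.mem_iUnion.2 ⟨n, Set.mem_biUnion hn hqa⟩
  have hcompact : IsCompact (unitary ℍ[ℝ] : Set ℍ[ℝ]) := hunit ▸ isCompact_sphere 0 1
  obtain ⟨n, hn⟩ := hcompact.elim_directed_cover _
    (fun n => isOpen_biUnion fun _ _ => Metric.isOpen_ball) hcover
    (directed_of_isDirected_le fun m n h => Set.biUnion_subset_biUnion_left (hmono h))
  refine ⟨n, fun q hq => ?_⟩
  obtain ⟨a, ha, hqa⟩ := Set.mem_iUnion₂.1 (hn hq)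
  refine ⟨a, ha, ?_⟩
  rw [← dist_eq_norm, dist_comm]
  exact (Metric.mem_ball.1 hqa).le

/-- Approximate `q` by `u`, write the small rotation `q u⁻¹` as a balanced commutator and
approximate its two entries: the errors enter the commutator to order `δ ^ (3 / 2)` only. -/
theorem IsWordFiltration.isUnitNet_step (h : IsWordFiltration κ Γ) {δ : ℝ} {n : ℕ}
    (hδ0 : 0 ≤ δ) (hδ1 : δ ≤ 1) (hnet : IsUnitNet δ (Γ n)) :
    IsUnitNet (10 * √δ * δ) (Γ ((2 * κ + 3) * n)) := by
  intro q hq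
  obtain ⟨u, hu, huq⟩ := hnet q hq
  have hu1 := h.subset_unitary n hu
  have hw : ‖q * star u - 1‖ ≤ δ := by
    rwa [← Unitary.mul_star_self_of_mem hu1, ← sub_mul,
      CStarRing.norm_mul_mem_unitary _ (Unitary.star_mem hu1), norm_sub_rev]
  obtain ⟨a, ha, b, hb, ha1, hb1, hab⟩ :=
    exists_balanced_commutator (MulMemClass.mul_mem hq (Unitary.star_mem hu1))
  obtain ⟨a', ha', haa⟩ := hnet a ha
  obtain ⟨b', hb', hbb⟩ := hnet b hb
  refine ⟨a' * b' * star a' * star b' * u, ?_, ?_⟩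
  · convert h.mul_mem (h.mul_mem (h.mul_mem (h.mul_mem ha' hb') (h.star_mem ha'))
      (h.star_mem hb')) hu using 1
    ring_nf
  · have hq' : q = a * b * star a * star b * u := by
      rw [hab, mul_assoc, Unitary.star_mul_self_of_mem hu1, mul_one]
    have hcomm := norm_groupCommutator_sub_le ha hb (h.subset_unitary n ha')
      (h.subset_unitary n hb') (Real.le_sqrt_of_sq_le (ha1.trans hw))
      (Real.le_sqrt_of_sq_le (hb1.trans hw)) haa hbb
    rw [hq', ← sub_mul, CStarRing.norm_mul_mem_unitary _ hu1]
    refine hcomm.trans ?_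
    have hsqrt : δ ≤ √δ := Real.le_sqrt_of_sq_le (by nlinarith)
    rw [Real.sq_sqrt hδ0]
    nlinarith [mul_le_mul_of_nonneg_right hsqrt hδ0]

theorem IsWordFiltration.isUnitNet_iterate (h : IsWordFiltration κ Γ) {c δ : ℝ} {n : ℕ}
    (hc : 1 ≤ c) (hδ : δ = 1 / (10 * c) ^ 2) (hnet : IsUnitNet δ (Γ n)) (k : ℕ) :
    IsUnitNet (δ / c ^ k) (Γ ((2 * κ + 3) ^ k * n)) := by
  have hδ0 : 0 ≤ δ := hδ ▸ by positivity
  have hδ1 : δ ≤ 1 := by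
    rw [hδ]
    exact div_le_one_of_le₀ (one_le_pow₀ (by linarith)) (by positivity)
  induction k with
  | zero => simpa using hnet
  | succ k ih =>
    have hle : δ / c ^ k ≤ δ := div_le_self hδ0 (one_le_pow₀ hc)
    have hsqrt : 10 * √(δ / c ^ k) ≤ 1 / c := by
      calc 10 * √(δ / c ^ k) ≤ 10 * √δ := by gcongr
        _ = 10 * (1 / (10 * c)) := by
            rw [hδ, ← one_div_pow, Real.sqrt_sq (by positivity)]
        _ = 1 / c := by field_simp
    intro q hq
    obtain ⟨a, ha, haq⟩ := h.isUnitNet_step (by positivity) (hle.trans hδ1) ih q hq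
    refine ⟨a, by rwa [pow_succ', mul_assoc], haq.trans ?_⟩
    calc 10 * √(δ / c ^ k) * (δ / c ^ k) ≤ 1 / c * (δ / c ^ k) := by gcongr
      _ = δ / c ^ (k + 1) := by rw [pow_succ]; field_simp

/-- The full Solovay–Kitaev theorem has `O(log(1/δ) ^ c)` in place of `O(δ ^ (-s))`. -/
theorem IsWordFiltration.exists_isUnitNet_rpow (h : IsWordFiltration κ Γ)
    (hdense : (unitary ℍ[ℝ] : Set ℍ[ℝ]) ⊆ closure (⋃ n, Γ n)) {s : ℝ} (hs : 0 < s) :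
    ∃ C : ℝ, 0 < C ∧ ∀ δ : ℝ, 0 < δ → δ ≤ 1 →
      ∃ n : ℕ, (n : ℝ) ≤ C * δ ^ (-s) ∧ IsUnitNet δ (Γ n) := by
  set c : ℝ := ((2 * κ + 3 : ℕ) : ℝ) ^ s⁻¹
  have hbase : 1 < ((2 * κ + 3 : ℕ) : ℝ) := by exact_mod_cast (by omega : 1 < 2 * κ + 3)
  have hc1 : 1 < c := Real.one_lt_rpow hbase (inv_pos.2 hs)
  have hcs : c ^ s = (2 * κ + 3 : ℕ) := Real.rpow_inv_rpow (by positivity) hs.ne'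
  obtain ⟨L, hL⟩ := exists_isUnitNet h.mono hdense (δ := 1 / (10 * c) ^ 2) (by positivity)
  refine ⟨(2 * κ + 3 : ℕ) * (L + 1), by positivity, fun δ hδ hδ1 => ?_⟩
  obtain ⟨k, hk, hk'⟩ := exists_nat_pow_near (one_le_one_div hδ hδ1) hc1
  refine ⟨(2 * κ + 3) ^ (k + 1) * L, ?_, fun q hq => ?_⟩
  · have hpow : (((2 * κ + 3 : ℕ) : ℝ)) ^ k ≤ δ ^ (-s) := by
      rw [← hcs, ← Real.rpow_natCast, ← Real.rpow_mul (by positivity), mul_comm,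
        Real.rpow_mul (by positivity), Real.rpow_natCast, Real.rpow_neg hδ.le,
        ← Real.inv_rpow hδ.le, ← one_div]
      gcongr
    rw [Nat.cast_mul, Nat.cast_pow, pow_succ]
    calc ((2 * κ + 3 : ℕ) : ℝ) ^ k * (2 * κ + 3 : ℕ) * L
        ≤ δ ^ (-s) * (2 * κ + 3 : ℕ) * (L + 1) := by gcongr; linarith
      _ = (2 * κ + 3 : ℕ) * (L + 1) * δ ^ (-s) := by ring
  · obtain ⟨a, ha, haq⟩ := h.isUnitNet_iterate hc1.le rfl hL (k + 1) q hq
    refine ⟨a, ha, haq.trans ?_⟩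
    calc 1 / (10 * c) ^ 2 / c ^ (k + 1) ≤ 1 / c ^ (k + 1) := by
          gcongr
          exact div_le_one_of_le₀ (one_le_pow₀ (by linarith)) (by positivity)
      _ ≤ δ := by
          rw [div_le_iff₀ (by positivity)]
          exact ((div_lt_iff₀ hδ).1 hk').le.trans_eq (mul_comm _ _)

end SolovayKitaev

section Rotation

/-- `u` is an imaginary unit of `ℍ[ℝ]`, regarded as the axis of a group of rotations. -/
def IsAxis (u : ℍ[ℝ]) : Prop := u.re = 0 ∧ u ∈ unitary ℍ[ℝ]

/-- The unit quaternion `exp (θ u)`, for an axis `u`: a rotation by the angle `2 θ` about `u`. -/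
noncomputable def rot (u : ℍ[ℝ]) (θ : ℝ) : ℍ[ℝ] := Real.cos θ • 1 + Real.sin θ • u

/-- The axis of the rotation `q`, a junk value if `q` is real. -/
noncomputable def axis (q : ℍ[ℝ]) : ℍ[ℝ] := ‖q.im‖⁻¹ • q.im

theorem isAxis_norm_inv_smul {p : ℍ[ℝ]} (hre : p.re = 0) (hp : p ≠ 0) : IsAxis (‖p‖⁻¹ • p) :=
  ⟨by simp [hre], norm_inv_smul_mem_unitary hp⟩

theorem isAxis_axis {q : ℍ[ℝ]} (hq : q.im ≠ 0) : IsAxis (axis q) :=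
  isAxis_norm_inv_smul (Quaternion.re_im q) hq

theorem IsAxis.star_eq {u : ℍ[ℝ]} (hu : IsAxis u) : star u = -u :=
  Quaternion.star_eq_neg.2 hu.1

theorem IsAxis.mul_self {u : ℍ[ℝ]} (hu : IsAxis u) : u * u = -1 := by
  rw [← neg_eq_iff_eq_neg, ← mul_neg, ← hu.star_eq, Unitary.mul_star_self_of_mem hu.2]

theorem IsAxis.sum_sq {u : ℍ[ℝ]} (hu : IsAxis u) : u.imI ^ 2 + u.imJ ^ 2 + u.imK ^ 2 = 1 := by
  have h := quaternion_norm_sq u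
  rw [hu.1, CStarRing.norm_of_mem_unitary hu.2] at h
  linarith

theorem IsAxis.conj {u k : ℍ[ℝ]} (hu : IsAxis u) (hk : k ∈ unitary ℍ[ℝ]) :
    IsAxis (k * u * star k) := by
  refine ⟨?_, mul_mem (mul_mem hk hu.2) (Unitary.star_mem hk)⟩
  simp [hu.1]
  ring

theorem rot_zero (u : ℍ[ℝ]) : rot u 0 = 1 := by simp [rot]

theorem rot_add {u : ℍ[ℝ]} (hu : IsAxis u) (θ φ : ℝ) : rot u (θ + φ) = rot u θ * rot u φ := by
  simp only [rot, Real.cos_add, Real.sin_add, mul_add, add_mul, smul_mul_smul_comm, hu.mul_self,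
    one_mul, mul_one]
  module

theorem star_rot {u : ℍ[ℝ]} (hu : IsAxis u) (θ : ℝ) : star (rot u θ) = rot u (-θ) := by
  simp [rot, hu.star_eq]

theorem rot_mem_unitary {u : ℍ[ℝ]} (hu : IsAxis u) (θ : ℝ) : rot u θ ∈ unitary ℍ[ℝ] := by
  rw [Unitary.mem_iff, star_rot hu, ← rot_add hu, ← rot_add hu]
  simp [rot_zero]

theorem conj_rot {k : ℍ[ℝ]} (hk : k ∈ unitary ℍ[ℝ]) (u : ℍ[ℝ]) (θ : ℝ) :
    k * rot u θ * star k = rot (k * u * star k) θ := by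
  simp [rot, mul_add, add_mul, Unitary.mul_star_self_of_mem hk]

theorem exists_cos_eq_sin_eq {x y : ℝ} (h : x ^ 2 + y ^ 2 = 1) :
    ∃ θ : ℝ, Real.cos θ = x ∧ Real.sin θ = y := by
  have hnorm : ‖(⟨x, y⟩ : ℂ)‖ = 1 := by
    rw [Complex.norm_def, Complex.normSq_mk, ← sq, ← sq, h, Real.sqrt_one]
  obtain ⟨θ, hθ⟩ := (Complex.norm_eq_one_iff _).1 hnorm
  exact ⟨θ, by rw [← Complex.exp_ofReal_mul_I_re, hθ], by rw [← Complex.exp_ofReal_mul_I_im, hθ]⟩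

theorem exists_eq_rot_of_commute {a u : ℍ[ℝ]} (ha : a ∈ unitary ℍ[ℝ]) (hu : IsAxis u)
    (h : Commute a u) : ∃ θ, a = rot u θ := by
  have hu0 := hu.1
  have hu1 := hu.sum_sq
  set t : ℝ := a.imI * u.imI + a.imJ * u.imJ + a.imK * u.imK with ht
  have him : a.imI = t * u.imI ∧ a.imJ = t * u.imJ ∧ a.imK = t * u.imK := by
    simp only [Commute, SemiconjBy, Quaternion.ext_iff] at h
    simp only [Quaternion.re_mul, hu0, mul_zero, zero_sub, zero_mul, Quaternion.imI_mul, add_zero,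
      zero_add, Quaternion.imJ_mul, Quaternion.imK_mul] at h
    obtain ⟨-, h1, h2, h3⟩ := h
    rw [ht]
    refine ⟨?_, ?_, ?_⟩
    · linear_combination -a.imI * hu1 + u.imJ * h3 / 2 - u.imK * h2 / 2
    · linear_combination -a.imJ * hu1 + u.imK * h1 / 2 - u.imI * h3 / 2
    · linear_combination -a.imK * hu1 + u.imI * h2 / 2 - u.imJ * h1 / 2
  obtain ⟨hI, hJ, hK⟩ := him
  have hn := quaternion_norm_sq a
  rw [CStarRing.norm_of_mem_unitary ha, hI, hJ, hK] at hn
  obtain ⟨θ, hc, hs⟩ := exists_cos_eq_sin_eq (x := a.re) (y := t)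
    (by linear_combination -hn - t ^ 2 * hu1)
  refine ⟨θ, ?_⟩
  ext <;> simp [rot, hc, hs, hu0, hI, hJ, hK]

theorem eq_rot_axis {q : ℍ[ℝ]} (hq : q ∈ unitary ℍ[ℝ]) (him : q.im ≠ 0) :
    q = rot (axis q) (Real.arccos q.re) := by
  have h := quaternion_norm_sq_eq_re_add_im q
  rw [CStarRing.norm_of_mem_unitary hq] at h
  have hsq : 1 - q.re ^ 2 = ‖q.im‖ ^ 2 := by linarith
  rw [rot, Real.cos_arccos (by nlinarith [sq_nonneg ‖q.im‖]) (by nlinarith [sq_nonneg ‖q.im‖]),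
    Real.sin_arccos, hsq, Real.sqrt_sq (norm_nonneg _), axis,
    smul_inv_smul₀ (norm_ne_zero_iff.2 him)]
  ext <;> simp

/-- Were the angle a rational multiple of `π`, then `2 cos θ - 1 = √2 / 2` would be an algebraic
integer, and so would its square `1 / 2`. -/
theorem irrational_arccos_div_two_pi :
    Irrational (Real.arccos ((1 + √2 / 2) / 2) / (2 * Real.pi)) := by
  rintro ⟨r, hr⟩
  have hsq : √2 ^ 2 = 2 := Real.sq_sqrt zero_le_two
  have hcos : 2 * Real.cos ((2 * r : ℚ) * Real.pi) = 1 + √2 / 2 := by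
    have harccos : ((2 * r : ℚ) : ℝ) * Real.pi = Real.arccos ((1 + √2 / 2) / 2) := by
      push_cast
      rw [hr]
      field_simp
    rw [harccos, Real.cos_arccos] <;> nlinarith [Real.sqrt_nonneg 2]
  have hint : IsIntegral ℤ ((1 / 2 : ℚ) : ℝ) := by
    have h : ((1 / 2 : ℚ) : ℝ) = (2 * Real.cos ((2 * r : ℚ) * Real.pi) - 1) ^ 2 := by
      rw [hcos]
      push_cast
      linear_combination -hsq / 4
    rw [h]
    exact ((Real.isIntegral_two_mul_cos_rat_mul_pi _).sub isIntegral_one).pow 2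
  obtain ⟨k, hk⟩ := (IsIntegral.exists_int_iff_exists_rat hint).1 ⟨_, rfl⟩
  have h2 : (2 * k : ℝ) = 1 := by rw [← hk]; norm_num
  norm_cast at h2
  omega

end Rotation

section Density

variable {K : Submonoid ℍ[ℝ]}

theorem rot_zsmul_mem (hstar : ∀ a ∈ K, star a ∈ K) {u : ℍ[ℝ]} (hu : IsAxis u) {θ : ℝ}
    (h : rot u θ ∈ K) (n : ℤ) : rot u (n * θ) ∈ K := by
  have hnat : ∀ n : ℕ, rot u (n * θ) ∈ K := by
    intro n
    induction n with
    | zero => simp [rot_zero]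
    | succ n ih =>
      rw [Nat.cast_succ, add_mul, one_mul, rot_add hu]
      exact K.mul_mem ih h
  obtain ⟨k, rfl | rfl⟩ := n.eq_nat_or_neg
  · exact_mod_cast hnat k
  · simpa [star_rot hu] using hstar _ (hnat k)

theorem rot_mem_of_irrational (hK : IsClosed (K : Set ℍ[ℝ])) (hstar : ∀ a ∈ K, star a ∈ K)
    {u : ℍ[ℝ]} (hu : IsAxis u) {θ : ℝ} (hθ : Irrational (θ / (2 * Real.pi))) (h : rot u θ ∈ K)
    (φ : ℝ) : rot u φ ∈ K := by
  let f : Real.Angle → ℍ[ℝ] := fun a => a.cos • 1 + a.sin • u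
  have hf : Continuous f :=
    (Real.Angle.continuous_cos.smul continuous_const).add
      (Real.Angle.continuous_sin.smul continuous_const)
  have hfrot : ∀ x : ℝ, f x = rot u x := fun x => by simp [f, rot]
  rw [← hfrot]
  refine isClosed_property (p := fun a => f a ∈ K)
    (AddCircle.denseRange_zsmul_coe_iff.2 hθ) (hK.preimage hf) (fun n => ?_) φ
  rw [← AddCircle.coe_zsmul, zsmul_eq_mul]
  exact (hfrot (n * θ)).symm ▸ rot_zsmul_mem hstar hu h n

/-- Rotating `u` about `v` traces a circle, which meets the plane orthogonal to `u` as soon as the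
angle between `u` and `v` is at least `π / 4`. -/
theorem exists_orthogonal_axis (hstar : ∀ a ∈ K, star a ∈ K) {u v : ℍ[ℝ]} (hu : IsAxis u)
    (hv : IsAxis v) (huv : inner ℝ u v ^ 2 ≤ 1 / 2) (huK : ∀ φ, rot u φ ∈ K)
    (hvK : ∀ φ, rot v φ ∈ K) :
    ∃ w, IsAxis w ∧ w * u = -(u * w) ∧ ∀ φ, rot w φ ∈ K := by
  have hd : inner ℝ u v = u.imI * v.imI + u.imJ * v.imJ + u.imK * v.imK := by
    simp [Quaternion.inner_def, hu.1]
  set d := u.imI * v.imI + u.imJ * v.imJ + u.imK * v.imK with hdd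
  rw [hd] at huv
  have hpos : 0 < 2 - 2 * d ^ 2 := by linarith
  obtain ⟨b, -, hs⟩ := exists_cos_eq_sin_eq (x := √(1 - 1 / (2 - 2 * d ^ 2)))
    (y := √(1 / (2 - 2 * d ^ 2))) (by
      rw [Real.sq_sqrt, Real.sq_sqrt (by positivity)]
      · ring
      · rw [sub_nonneg, div_le_one hpos]; linarith)
  have hs2 : Real.sin b ^ 2 * (2 - 2 * d ^ 2) = 1 := by
    rw [hs, Real.sq_sqrt (by positivity), one_div_mul_cancel hpos.ne']
  have hk := rot_mem_unitary hv b
  set w := rot v b * u * star (rot v b) with hw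
  have hwu : IsAxis w := hu.conj hk
  have horth : w.imI * u.imI + w.imJ * u.imJ + w.imK * u.imK = 0 := by
    have hexpand : w.imI * u.imI + w.imJ * u.imJ + w.imK * u.imK =
        Real.cos b ^ 2 * (u.imI ^ 2 + u.imJ ^ 2 + u.imK ^ 2) + Real.sin b ^ 2 * (2 * d ^ 2 -
          (u.imI ^ 2 + u.imJ ^ 2 + u.imK ^ 2) * (v.imI ^ 2 + v.imJ ^ 2 + v.imK ^ 2)) := by
      simp [hw, rot, hu.1, hv.1, hdd]
      ring
    rw [hexpand, hu.sum_sq, hv.sum_sq]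
    linear_combination Real.cos_sq_add_sin_sq b - hs2
  refine ⟨w, hwu, ?_, fun φ => ?_⟩
  · ext <;> simp [hwu.1, hu.1] <;> linarith
  · rw [← conj_rot hk]
    exact K.mul_mem (K.mul_mem (hvK _) (huK _)) (hstar _ (hvK _))

theorem rot_mem_of_anticommute (hstar : ∀ a ∈ K, star a ∈ K) {u w y : ℍ[ℝ]} (hu : IsAxis u)
    (hw : IsAxis w) (hy : IsAxis y) (hwu : w * u = -(u * w)) (hyu : y * u = -(u * y))
    (huK : ∀ φ, rot u φ ∈ K) (hwK : ∀ φ, rot w φ ∈ K) (φ : ℝ) : rot y φ ∈ K := by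
  have hcomm : Commute (y * star w) u := by
    simp only [Commute, SemiconjBy, hw.star_eq, mul_neg, neg_mul, mul_assoc, hwu, neg_neg]
    rw [← mul_assoc, hyu, neg_mul, mul_assoc]
  obtain ⟨θ, hθ⟩ :=
    exists_eq_rot_of_commute (mul_mem hy.2 (Unitary.star_mem hw.2)) hu hcomm
  have hshift : w * star (rot u (θ / 2)) = rot u (θ / 2) * w := by
    rw [star_rot hu]
    simp [rot, mul_add, add_mul, hwu]
  have hyw : y = rot u (θ / 2) * w * star (rot u (θ / 2)) := by
    rw [mul_assoc, hshift, ← mul_assoc, ← rot_add hu, add_halves, ← hθ, mul_assoc,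
      Unitary.star_mul_self_of_mem hw.2, mul_one]
  rw [hyw, ← conj_rot (rot_mem_unitary hu _)]
  exact K.mul_mem (K.mul_mem (huK _) (hwK _)) (hstar _ (huK _))

theorem IsAxis.lie_mul_eq_neg {u x : ℍ[ℝ]} (hu : IsAxis u) : ⁅u, x⁆ * u = -(u * ⁅u, x⁆) := by
  have h1 : u * (u * x) = -x := by rw [← mul_assoc, hu.mul_self, neg_one_mul]
  have h2 : x * u * u = -x := by rw [mul_assoc, hu.mul_self, mul_neg_one]
  rw [Ring.lie_def, sub_mul, mul_sub, h1, h2, mul_assoc]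
  abel

theorem IsAxis.rot_mem_of_orthogonal_axes (hstar : ∀ a ∈ K, star a ∈ K) {u w x : ℍ[ℝ]}
    (hx : IsAxis x) (hu : IsAxis u) (hw : IsAxis w) (hwu : w * u = -(u * w))
    (huK : ∀ φ, rot u φ ∈ K) (hwK : ∀ φ, rot w φ ∈ K) (φ : ℝ) : rot x φ ∈ K := by
  by_cases h : ⁅u, x⁆ = 0
  · rw [Ring.lie_def, sub_eq_zero] at h
    obtain ⟨θ, hθ⟩ := exists_eq_rot_of_commute hx.2 hu h.symm
    have hcos : Real.cos θ = 0 := by simpa [hθ, rot, hu.1] using hx.1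
    have hxw : x * w = -(w * x) := by
      rw [hθ, rot, hcos]
      simp [hwu]
    exact rot_mem_of_anticommute hstar hw hu hx (by rw [hwu, neg_neg]) hxw hwK huK φ
  · have hre : (⁅u, x⁆).re = 0 := by
      simp [Ring.lie_def, hu.1, hx.1]
      ring
    have hy := isAxis_norm_inv_smul hre h
    have hyu : ‖⁅u, x⁆‖⁻¹ • ⁅u, x⁆ * u = -(u * ‖⁅u, x⁆‖⁻¹ • ⁅u, x⁆) := by
      rw [smul_mul_assoc, hu.lie_mul_eq_neg, mul_smul_comm, smul_neg]
    have hxy : x * ‖⁅u, x⁆‖⁻¹ • ⁅u, x⁆ = -(‖⁅u, x⁆‖⁻¹ • ⁅u, x⁆ * x) := by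
      have hlie : ⁅u, x⁆ = -⁅x, u⁆ := by simp [Ring.lie_def]
      rw [smul_mul_assoc, mul_smul_comm, hlie, neg_mul, hx.lie_mul_eq_neg]
      simp
    exact rot_mem_of_anticommute hstar hy hu hx (by rw [hyu, neg_neg]) hxy
      (rot_mem_of_anticommute hstar hu hw hy hwu hyu huK hwK) huK φ

theorem unitary_subset_of_orthogonal_axes (hstar : ∀ a ∈ K, star a ∈ K) {u w : ℍ[ℝ]}
    (hu : IsAxis u) (hw : IsAxis w) (hwu : w * u = -(u * w)) (huK : ∀ φ, rot u φ ∈ K)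
    (hwK : ∀ φ, rot w φ ∈ K) : (unitary ℍ[ℝ] : Set ℍ[ℝ]) ⊆ K := by
  intro q hq
  by_cases h : q.im = 0
  · have hcomm : Commute q u := by
      rw [← Quaternion.re_add_im q, h, add_zero]
      exact Quaternion.coe_commutes _ _
    obtain ⟨θ, hθ⟩ := exists_eq_rot_of_commute hq hu hcomm
    exact hθ ▸ huK θ
  · rw [eq_rot_axis hq h]
    exact (isAxis_axis h).rot_mem_of_orthogonal_axes hstar hu hw hwu huK hwK _

theorem rot_axis_mem (hK : IsClosed (K : Set ℍ[ℝ])) (hstar : ∀ a ∈ K, star a ∈ K) {q : ℍ[ℝ]}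
    (hq : q ∈ K) (hu : q ∈ unitary ℍ[ℝ]) (him : q.im ≠ 0) (hre : q.re = (1 + √2 / 2) / 2)
    (φ : ℝ) : rot (axis q) φ ∈ K := by
  rw [eq_rot_axis hu him] at hq
  exact rot_mem_of_irrational hK hstar (isAxis_axis him)
    (hre ▸ irrational_arccos_div_two_pi) hq φ

/-- The rotation implemented by `T H T⁷ H`. -/
noncomputable def rotA : ℍ[ℝ] :=
  quat ((1 + √2 / 2) / 2) (-(√2 / 4)) (-((1 - √2 / 2) / 2)) (√2 / 4)

/-- The rotation implemented by `T³ H T⁷ H T⁶`. -/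
noncomputable def rotB : ℍ[ℝ] :=
  quat ((1 + √2 / 2) / 2) ((1 - √2 / 2) / 2) (-(√2 / 4)) (√2 / 4)

theorem rotA_mem_unitary : rotA ∈ unitary ℍ[ℝ] := by
  apply mem_unitary_quaternion_of_sum_sq
  simp only [rotA, quat_re, quat_imI, quat_imJ, quat_imK]
  linear_combination Real.sq_sqrt (zero_le_two (α := ℝ)) / 4

theorem rotB_mem_unitary : rotB ∈ unitary ℍ[ℝ] := by
  apply mem_unitary_quaternion_of_sum_sq
  simp only [rotB, quat_re, quat_imI, quat_imJ, quat_imK]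
  linear_combination Real.sq_sqrt (zero_le_two (α := ℝ)) / 4

theorem norm_im_sq_of_re_eq {q : ℍ[ℝ]} (hq : q ∈ unitary ℍ[ℝ]) (hre : q.re = (1 + √2 / 2) / 2) :
    1 / 4 ≤ ‖q.im‖ ^ 2 := by
  have h := quaternion_norm_sq_eq_re_add_im q
  rw [CStarRing.norm_of_mem_unitary hq, hre] at h
  nlinarith [Real.sq_sqrt (zero_le_two (α := ℝ)), Real.sqrt_nonneg 2]

theorem inner_axis_rotA_axis_rotB_sq_le : inner ℝ (axis rotA) (axis rotB) ^ 2 ≤ 1 / 2 := by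
  have hsq : √2 ^ 2 = 2 := Real.sq_sqrt zero_le_two
  have him : inner ℝ rotA.im rotB.im = 1 / 8 := by
    simp [Quaternion.inner_def, rotA, rotB]
    linear_combination hsq / 16
  have hA := norm_im_sq_of_re_eq rotA_mem_unitary rfl
  have hB := norm_im_sq_of_re_eq rotB_mem_unitary rfl
  have hAB : 1 / 16 ≤ ‖rotA.im‖ ^ 2 * ‖rotB.im‖ ^ 2 := by nlinarith
  calc inner ℝ (axis rotA) (axis rotB) ^ 2
      = (1 / 8) ^ 2 / (‖rotA.im‖ ^ 2 * ‖rotB.im‖ ^ 2) := by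
        rw [axis, axis, real_inner_smul_left, real_inner_smul_right, him]
        ring
    _ ≤ (1 / 8) ^ 2 / (1 / 16) := by gcongr
    _ ≤ 1 / 2 := by norm_num

theorem unitary_subset_of_rotA_mem_of_rotB_mem (hK : IsClosed (K : Set ℍ[ℝ]))
    (hstar : ∀ a ∈ K, star a ∈ K) (hA : rotA ∈ K) (hB : rotB ∈ K) :
    (unitary ℍ[ℝ] : Set ℍ[ℝ]) ⊆ K := by
  have im_ne_zero : ∀ {q : ℍ[ℝ]}, q ∈ unitary ℍ[ℝ] → q.re = (1 + √2 / 2) / 2 → q.im ≠ 0 := by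
    intro q hq hre h
    have := norm_im_sq_of_re_eq hq hre
    rw [h, norm_zero] at this
    norm_num at this
  have hAim := im_ne_zero rotA_mem_unitary rfl
  have hBim := im_ne_zero rotB_mem_unitary rfl
  have hAK := rot_axis_mem hK hstar hA rotA_mem_unitary hAim rfl
  have hBK := rot_axis_mem hK hstar hB rotB_mem_unitary hBim rfl
  obtain ⟨w, hw, hwu, hwK⟩ := exists_orthogonal_axis hstar (isAxis_axis hAim) (isAxis_axis hBim)
    inner_axis_rotA_axis_rotB_sq_le hAK hBK
  exact unitary_subset_of_orthogonal_axes hstar (isAxis_axis hAim) hw hwu hAK hwK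

end Density

section Tensor

variable {ι : Type*} [Fintype ι]

/-- The tensor product `⨂ᵢ f i` of one-spin operators. -/
def piKronecker (f : ι → Matrix (Fin 2) (Fin 2) ℂ) : Matrix (ι → Fin 2) (ι → Fin 2) ℂ :=
  Matrix.of fun x y => ∏ i, f i (x i) (y i)

theorem star_piKronecker (f : ι → Matrix (Fin 2) (Fin 2) ℂ) :
    star (piKronecker f) = piKronecker (star f) := by
  ext x y
  simp [piKronecker, Matrix.star_apply]

theorem piKronecker_one : piKronecker (1 : ι → Matrix (Fin 2) (Fin 2) ℂ) = 1 := by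
  ext x y
  simp only [piKronecker, Matrix.of_apply, Pi.one_apply, Matrix.one_apply]
  rw [Fintype.prod_ite_zero]
  simp [funext_iff]

theorem piKronecker_diagonal (d : ι → Fin 2 → ℂ) :
    piKronecker (fun i => Matrix.diagonal (d i)) = Matrix.diagonal fun x => ∏ i, d i (x i) := by
  ext x y
  simp only [piKronecker, Matrix.of_apply, Matrix.diagonal_apply, Fintype.prod_ite_zero,
    funext_iff]

variable [DecidableEq ι]

theorem piKronecker_mul (f g : ι → Matrix (Fin 2) (Fin 2) ℂ) :
    piKronecker f * piKronecker g = piKronecker (f * g) := by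
  ext x y
  simp only [Matrix.mul_apply, piKronecker, Matrix.of_apply, Finset.prod_univ_sum,
    Fintype.piFinset_univ, Finset.prod_mul_distrib, Pi.mul_apply]

theorem piKronecker_mem_unitary {f : ι → Matrix (Fin 2) (Fin 2) ℂ}
    (hf : ∀ i, f i ∈ unitary (Matrix (Fin 2) (Fin 2) ℂ)) :
    piKronecker f ∈ unitary (Matrix (ι → Fin 2) (ι → Fin 2) ℂ) := by
  rw [Unitary.mem_iff, star_piKronecker, piKronecker_mul, piKronecker_mul]
  have h1 : star f * f = 1 := funext fun i => (hf i).1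
  have h2 : f * star f = 1 := funext fun i => (hf i).2
  rw [h1, h2, piKronecker_one]
  exact ⟨rfl, rfl⟩

end Tensor

section OnQubit

variable {N : ℕ}

theorem onQubit_eq_piKronecker (i : Fin N) (g : Matrix (Fin 2) (Fin 2) ℂ) :
    onQubit i g = piKronecker (Function.update 1 i g) := by
  ext x y
  simp only [onQubit, piKronecker, Matrix.of_apply]
  rw [← Finset.mul_prod_erase _ _ (Finset.mem_univ i), Function.update_self]
  have hoff : ∀ j ∈ Finset.univ.erase i, (Function.update 1 i g : Fin N → Matrix _ _ ℂ) j
      (x j) (y j) = if x j = y j then 1 else 0 := by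
    intro j hj
    rw [Function.update_of_ne (Finset.ne_of_mem_erase hj)]
    exact Matrix.one_apply
  rw [Finset.prod_congr rfl hoff, Finset.prod_ite_zero]
  simp

theorem eq_iff_forall_ne_and_eq {x y : Basis N} (i : Fin N) :
    x = y ↔ (∀ j, j ≠ i → x j = y j) ∧ x i = y i := by
  refine ⟨fun h => h ▸ ⟨fun _ _ => rfl, rfl⟩, fun h => funext fun j => ?_⟩
  rcases eq_or_ne j i with rfl | hj
  exacts [h.2, h.1 j hj]

theorem onQubit_diagonal (i : Fin N) (d : Fin 2 → ℂ) :
    onQubit i (Matrix.diagonal d) = Matrix.diagonal fun x => d (x i) := by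
  ext x y
  simp only [onQubit, Matrix.of_apply, Matrix.diagonal_apply, eq_iff_forall_ne_and_eq i, ite_and]

/-- `onQubit i` as a homomorphism of star algebras. -/
def onQubitHom (i : Fin N) : Matrix (Fin 2) (Fin 2) ℂ →⋆ₐ[ℂ] Op N where
  toFun := onQubit i
  map_one' := by
    rw [onQubit_eq_piKronecker, ← piKronecker_one]
    exact congrArg piKronecker (Function.update_eq_self i 1)
  map_mul' g h := by
    simp only [onQubit_eq_piKronecker, piKronecker_mul]
    rw [← Function.update_mul, one_mul]
  map_zero' := by
    ext x y
    simp [onQubit]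
  map_add' g h := by
    ext x y
    simp only [onQubit, Matrix.of_apply, Matrix.add_apply]
    split_ifs <;> simp
  commutes' c := by
    rw [Matrix.algebraMap_eq_diagonal, Matrix.algebraMap_eq_diagonal, onQubit_diagonal]
    rfl
  map_star' g := by
    simp only [onQubit_eq_piKronecker, star_piKronecker]
    refine congrArg piKronecker (funext fun j => ?_)
    rcases eq_or_ne j i with rfl | hj <;> simp [*]

theorem onQubitHom_apply (i : Fin N) (g : Matrix (Fin 2) (Fin 2) ℂ) :
    onQubitHom i g = onQubit i g := rfl

end OnQubit

section Gate

theorem ofReal_sqrt_two_sq : ((√2 : ℝ) : ℂ) ^ 2 = 2 := by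
  rw [← Complex.ofReal_pow, Real.sq_sqrt zero_le_two, Complex.ofReal_ofNat]

theorem hadamardMatrix_eq : hadamardMatrix = ((√2 / 2 : ℝ) : ℂ) • !![1, 1; 1, -1] := by
  rw [hadamardMatrix, ← Real.sqrt_div_self]

theorem star_hadamardMatrix : star hadamardMatrix = hadamardMatrix := by
  ext i j
  fin_cases i <;> fin_cases j <;> simp [hadamardMatrix_eq, Matrix.star_apply]

theorem hadamardMatrix_mul_diagonal_mul_hadamardMatrix (z : ℂ) :
    hadamardMatrix * !![1, 0; 0, z] * hadamardMatrix =
      !![(1 + z) / 2, (1 - z) / 2; (1 - z) / 2, (1 + z) / 2] := by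
  rw [hadamardMatrix_eq]
  ext i j
  fin_cases i <;> fin_cases j <;> simp [Matrix.mul_apply, Fin.sum_univ_two]
  · linear_combination (1 + z) / 4 * ofReal_sqrt_two_sq
  · linear_combination (1 - z) / 4 * ofReal_sqrt_two_sq
  · linear_combination (1 - z) / 4 * ofReal_sqrt_two_sq
  · linear_combination (1 + z) / 4 * ofReal_sqrt_two_sq

theorem hadamardMatrix_mem_unitary : hadamardMatrix ∈ unitary (Matrix (Fin 2) (Fin 2) ℂ) := by
  have h : hadamardMatrix * hadamardMatrix = 1 := by
    simpa [← Matrix.one_fin_two] using hadamardMatrix_mul_diagonal_mul_hadamardMatrix 1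
  rw [Unitary.mem_iff, star_hadamardMatrix, h]
  exact ⟨rfl, rfl⟩

/-- The primitive eighth root of unity `e^{iπ/4}`. -/
noncomputable def zeta8 : ℂ := Complex.exp (Complex.I * (Real.pi / 4 : ℝ))

theorem zeta8_eq : zeta8 = ((√2 / 2 : ℝ) : ℂ) * (1 + Complex.I) := by
  rw [zeta8, mul_comm, Complex.exp_mul_I, ← Complex.ofReal_cos, ← Complex.ofReal_sin,
    Real.cos_pi_div_four, Real.sin_pi_div_four]
  ring

theorem zeta8_sq : zeta8 ^ 2 = Complex.I := by
  rw [zeta8_eq]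
  push_cast
  linear_combination (Complex.I / 2 + (1 + Complex.I ^ 2) / 4) * ofReal_sqrt_two_sq +
    Complex.I_sq / 2

theorem star_zeta8_mul_self : star zeta8 * zeta8 = 1 := by
  rw [zeta8, Complex.star_def, ← Complex.exp_conj, ← Complex.exp_add, map_mul, Complex.conj_I,
    Complex.conj_ofReal, ← add_mul, neg_add_cancel, zero_mul, Complex.exp_zero]

theorem tMatrix_eq_diagonal : tMatrix = Matrix.diagonal ![1, zeta8] := by
  ext i j
  fin_cases i <;> fin_cases j <;> simp [tMatrix, zeta8]

theorem tMatrix_pow (n : ℕ) : tMatrix ^ n = !![1, 0; 0, zeta8 ^ n] := by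
  rw [tMatrix_eq_diagonal, Matrix.diagonal_pow]
  ext i j
  fin_cases i <;> fin_cases j <;> simp

theorem tMatrix_pow_eight : tMatrix ^ 8 = 1 := by
  have h : zeta8 ^ 8 = 1 := by
    rw [pow_mul zeta8 2 4, zeta8_sq, Complex.I_pow_four]
  rw [tMatrix_pow, h, Matrix.one_fin_two]

theorem tMatrix_mem_unitary : tMatrix ∈ unitary (Matrix (Fin 2) (Fin 2) ℂ) := by
  have h : star tMatrix * tMatrix = 1 := by
    rw [tMatrix_eq_diagonal, Matrix.star_eq_conjTranspose, Matrix.diagonal_conjTranspose,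
      Matrix.diagonal_mul_diagonal, ← Matrix.diagonal_one]
    congr 1
    ext i
    fin_cases i
    · simp
    · simpa using star_zeta8_mul_self
  exact ⟨h, mul_eq_one_comm.1 h⟩

theorem star_tMatrix : star tMatrix = tMatrix ^ 7 := by
  calc star tMatrix = star tMatrix * (tMatrix * tMatrix ^ 7) := by
        rw [← pow_succ', tMatrix_pow_eight, mul_one]
    _ = tMatrix ^ 7 := by rw [← mul_assoc, tMatrix_mem_unitary.1, one_mul]

variable {N : ℕ} {c t : Fin N}

theorem involutive_update_add (h : c ≠ t) :
    Function.Involutive fun y : Basis N => Function.update y t (y t + y c) := by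
  intro y
  have hself : ∀ a : Fin 2, a + a = 0 := by decide
  simp [Function.update_of_ne h, add_assoc, hself]

/-- The permutation of the basis states performed by a `CNOT`. -/
def cnotPerm (h : c ≠ t) : Equiv.Perm (Basis N) := (involutive_update_add h).toPerm

theorem cnotPerm_apply (h : c ≠ t) (y : Basis N) :
    cnotPerm h y = Function.update y t (y t + y c) := rfl

theorem inv_cnotPerm (h : c ≠ t) : (cnotPerm h)⁻¹ = cnotPerm h := rfl

theorem cnot_toOp_eq_permMatrix (h : c ≠ t) :
    (Gate.cnot c t h).toOp = (cnotPerm h).permMatrix ℂ := by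
  ext x y
  have hxy : x = cnotPerm h y ↔ cnotPerm h x = y := (cnotPerm h).symm_apply_eq.symm
  simp only [Gate.toOp, Matrix.of_apply, ← cnotPerm_apply h, hxy, Equiv.Perm.permMatrix,
    PEquiv.toMatrix_apply, Equiv.toPEquiv_apply, Option.mem_some_iff]

theorem star_cnot (h : c ≠ t) : star (Gate.cnot c t h).toOp = (Gate.cnot c t h).toOp := by
  rw [cnot_toOp_eq_permMatrix, Matrix.star_eq_conjTranspose, Matrix.conjTranspose_permMatrix,
    inv_cnotPerm]

theorem cnot_mul_diagonal_mul_cnot (h : c ≠ t) (d : Basis N → ℂ) :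
    (Gate.cnot c t h).toOp * Matrix.diagonal d * (Gate.cnot c t h).toOp =
      Matrix.diagonal (d ∘ cnotPerm h) := by
  rw [cnot_toOp_eq_permMatrix, PEquiv.toMatrix_toPEquiv_mul, PEquiv.mul_toMatrix_toPEquiv,
    Matrix.submatrix_submatrix]
  exact Matrix.submatrix_diagonal_equiv d (cnotPerm h)

theorem Gate.toOp_mem_unitary (g : Gate N) : g.toOp ∈ unitary (Op N) := by
  cases g with
  | hadamard i => exact Unitary.map_mem (onQubitHom i) hadamardMatrix_mem_unitary
  | phaseT i => exact Unitary.map_mem (onQubitHom i) tMatrix_mem_unitary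
  | cnot c t h =>
    have hsq : (Gate.cnot c t h).toOp * (Gate.cnot c t h).toOp = 1 := by
      have hone := cnot_mul_diagonal_mul_cnot h fun _ => 1
      rw [Matrix.diagonal_one, mul_one] at hone
      exact hone.trans Matrix.diagonal_one
    rw [Unitary.mem_iff, star_cnot, hsq]
    exact ⟨rfl, rfl⟩

theorem circuitOp_append (G G' : List (Gate N)) :
    circuitOp (G ++ G') = circuitOp G' * circuitOp G := by
  simp [circuitOp]

theorem circuitOp_nil : circuitOp ([] : List (Gate N)) = 1 := by
  simp [circuitOp]

theorem circuitOp_singleton (g : Gate N) : circuitOp [g] = g.toOp := by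
  simp [circuitOp]

theorem circuitOp_replicate (g : Gate N) (n : ℕ) :
    circuitOp (List.replicate n g) = g.toOp ^ n := by
  simp [circuitOp]

theorem circuitOp_mem_unitary (G : List (Gate N)) : circuitOp G ∈ unitary (Op N) := by
  refine Submonoid.list_prod_mem _ fun x hx => ?_
  simp only [List.mem_reverse, List.mem_map] at hx
  obtain ⟨g, -, rfl⟩ := hx
  exact g.toOp_mem_unitary

theorem Gate.exists_circuitOp_eq_star (g : Gate N) :
    ∃ G : List (Gate N), G.length ≤ 7 ∧ circuitOp G = star g.toOp := by
  cases g with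
  | hadamard i =>
    refine ⟨[.hadamard i], by simp, ?_⟩
    rw [circuitOp_singleton, Gate.toOp, ← onQubitHom_apply, ← map_star, star_hadamardMatrix]
  | phaseT i =>
    refine ⟨List.replicate 7 (.phaseT i), by simp, ?_⟩
    rw [circuitOp_replicate, Gate.toOp, ← onQubitHom_apply, ← map_star, star_tMatrix, map_pow]
  | cnot c t h => exact ⟨[.cnot c t h], by simp, by rw [circuitOp_singleton, star_cnot]⟩

theorem exists_circuitOp_eq_star (G : List (Gate N)) :
    ∃ G' : List (Gate N), G'.length ≤ 7 * G.length ∧ circuitOp G' = star (circuitOp G) := by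
  induction G with
  | nil => exact ⟨[], by simp, by simp [circuitOp_nil]⟩
  | cons g G ih =>
    obtain ⟨G₁, hl₁, hG₁⟩ := g.exists_circuitOp_eq_star
    obtain ⟨G₂, hl₂, hG₂⟩ := ih
    refine ⟨G₂ ++ G₁, by simp; omega, ?_⟩
    rw [circuitOp_append, hG₁, hG₂, ← star_mul, ← List.singleton_append, circuitOp_append,
      circuitOp_singleton]

end Gate

section HasCircuit

/-- Some circuit with at most `L` gates approximates `W` up to error `δ`. -/
def HasCircuit {N : ℕ} (δ L : ℝ) (W : Op N) : Prop :=
  ∃ G : List (Gate N), (G.length : ℝ) ≤ L ∧ ‖circuitOp G - W‖ ≤ δ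

namespace HasCircuit

variable {N : ℕ} {δ δ' L L' : ℝ} {W W' : Op N}

theorem mono (h : HasCircuit δ L W) (hδ : δ ≤ δ') (hL : L ≤ L') : HasCircuit δ' L' W := by
  obtain ⟨G, hG, hGW⟩ := h
  exact ⟨G, hG.trans hL, hGW.trans hδ⟩

theorem of_gate (g : Gate N) : HasCircuit 0 1 g.toOp :=
  ⟨[g], by simp, by simp [circuitOp_singleton]⟩

theorem one : HasCircuit 0 0 (1 : Op N) :=
  ⟨[], by simp, by simp [circuitOp_nil]⟩

theorem mem_unitary (h : HasCircuit 0 L W) : W ∈ unitary (Op N) := by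
  obtain ⟨G, -, hG⟩ := h
  rw [← sub_eq_zero.1 (norm_le_zero_iff.1 hG)]
  exact circuitOp_mem_unitary G

theorem mul (h : HasCircuit δ L W) (h' : HasCircuit δ' L' W') (hW' : W' ∈ unitary (Op N)) :
    HasCircuit (δ + δ') (L + L') (W * W') := by
  obtain ⟨G, hG, hGW⟩ := h
  obtain ⟨G', hG', hGW'⟩ := h'
  refine ⟨G' ++ G, by push_cast [List.length_append]; linarith, ?_⟩
  have hsplit : circuitOp G * circuitOp G' - W * W' =
      (circuitOp G - W) * W' + circuitOp G * (circuitOp G' - W') := by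
    noncomm_ring
  calc ‖circuitOp (G' ++ G) - W * W'‖
      ≤ ‖(circuitOp G - W) * W'‖ + ‖circuitOp G * (circuitOp G' - W')‖ := by
        rw [circuitOp_append, hsplit]
        exact norm_add_le _ _
    _ = ‖circuitOp G - W‖ + ‖circuitOp G' - W'‖ := by
        rw [CStarRing.norm_mul_mem_unitary _ hW',
          CStarRing.norm_mem_unitary_mul _ (circuitOp_mem_unitary G)]
    _ ≤ δ + δ' := add_le_add hGW hGW'

theorem star (h : HasCircuit δ L W) : HasCircuit δ (7 * L) (star W) := by
  obtain ⟨G, hG, hGW⟩ := h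
  obtain ⟨G', hG', hstar⟩ := exists_circuitOp_eq_star G
  refine ⟨G', ?_, by rwa [hstar, ← star_sub, norm_star]⟩
  calc (G'.length : ℝ) ≤ 7 * G.length := by exact_mod_cast hG'
    _ ≤ 7 * L := by gcongr

theorem of_norm_sub_le (h : HasCircuit δ L W) (hW : ‖W - W'‖ ≤ δ') :
    HasCircuit (δ + δ') L W' := by
  obtain ⟨G, hG, hGW⟩ := h
  exact ⟨G, hG, (norm_sub_le_norm_sub_add_norm_sub _ W _).trans (add_le_add hGW hW)⟩

theorem list_prod (l : List (Op N)) (h : ∀ W ∈ l, HasCircuit δ L W)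
    (hu : ∀ W ∈ l, W ∈ unitary (Op N)) :
    HasCircuit (l.length * δ) (l.length * L) l.prod := by
  induction l with
  | nil => simpa using one
  | cons W l ih =>
    rw [List.forall_mem_cons] at h hu
    rw [List.prod_cons, List.length_cons, Nat.cast_succ]
    exact (h.1.mul (ih h.2 hu.2) (Submonoid.list_prod_mem _ hu.2)).mono (by linarith) (by linarith)

theorem pow (h : HasCircuit 0 L W) (n : ℕ) : HasCircuit 0 (n * L) (W ^ n) := by
  rw [← List.prod_replicate]
  exact (list_prod (List.replicate n W) (fun V hV => List.eq_of_mem_replicate hV ▸ h)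
    fun V hV => List.eq_of_mem_replicate hV ▸ h.mem_unitary).mono (by simp) (by simp)

theorem piKronecker_of_onQubit {g : Fin N → Matrix (Fin 2) (Fin 2) ℂ}
    (h : ∀ i, HasCircuit 0 L (onQubit i (g i))) : HasCircuit 0 (N * L) (piKronecker g) := by
  suffices hF : ∀ F : Finset (Fin N),
      HasCircuit 0 (F.card * L) (piKronecker fun i => if i ∈ F then g i else 1) by
    simpa using hF Finset.univ
  intro F
  induction F using Finset.induction_on with
  | empty => simpa [← Pi.one_def, piKronecker_one] using one
  | insert a F ha ih =>
    have hinsert : (piKronecker fun i => if i ∈ insert a F then g i else 1) =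
        onQubit a (g a) * piKronecker fun i => if i ∈ F then g i else 1 := by
      rw [onQubit_eq_piKronecker, piKronecker_mul]
      refine congrArg piKronecker (funext fun i => ?_)
      rcases eq_or_ne i a with rfl | hi <;> simp [*]
    rw [hinsert]
    refine ((h a).mul ih ih.mem_unitary).mono (by simp) ?_
    rw [Finset.card_insert_of_notMem ha]
    push_cast
    linarith

end HasCircuit

end HasCircuit

section OneQubit

/-- The embedding of the quaternions into the `2 × 2` matrices, `i, j, k ↦ -iX, -iY, -iZ`. -/
def toMat : ℍ[ℝ] →⋆ₐ[ℝ] Matrix (Fin 2) (Fin 2) ℂ where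
  toFun q := !![⟨q.re, -q.imK⟩, ⟨-q.imJ, -q.imI⟩; ⟨q.imJ, -q.imI⟩, ⟨q.re, q.imK⟩]
  map_one' := by
    ext i j
    fin_cases i <;> fin_cases j <;> simp [Complex.ext_iff]
  map_mul' p q := by
    ext i j
    fin_cases i <;> fin_cases j <;>
      simp [Matrix.mul_apply, Fin.sum_univ_two, Complex.ext_iff] <;> constructor <;> ring
  map_zero' := by
    ext i j
    fin_cases i <;> fin_cases j <;> simp [Complex.ext_iff]
  map_add' p q := by
    ext i j
    fin_cases i <;> fin_cases j <;> simp [Complex.ext_iff, add_comm]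
  commutes' r := by
    ext i j
    fin_cases i <;> fin_cases j <;>
      simp [Complex.ext_iff, Matrix.algebraMap_matrix_apply]
  map_star' q := by
    ext i j
    fin_cases i <;> fin_cases j <;> simp [Matrix.star_apply, Complex.ext_iff]

theorem toMat_apply (q : ℍ[ℝ]) :
    toMat q = !![⟨q.re, -q.imK⟩, ⟨-q.imJ, -q.imI⟩; ⟨q.imJ, -q.imI⟩, ⟨q.re, q.imK⟩] := rfl

variable {N : ℕ}

theorem norm_onQubit_toMat (i : Fin N) (q : ℍ[ℝ]) : ‖onQubit i (toMat q)‖ = ‖q‖ := by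
  have h : star (onQubit i (toMat q)) * onQubit i (toMat q) = ((‖q‖ * ‖q‖ : ℝ) : ℂ) • 1 := by
    rw [← onQubitHom_apply, ← map_star, ← map_mul, ← map_star, ← map_mul,
      Quaternion.star_mul_self, Quaternion.normSq_eq_norm_mul_self,
      ← map_one (onQubitHom i), ← map_smul]
    congr 1
    ext i j
    fin_cases i <;> fin_cases j <;> simp [toMat_apply, Complex.ext_iff]
  have hnorm := CStarRing.norm_star_mul_self (x := onQubit i (toMat q))
  rw [h, norm_smul, norm_one, mul_one, Complex.norm_real,
    Real.norm_of_nonneg (by positivity)] at hnorm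
  exact ((mul_self_inj (norm_nonneg _) (norm_nonneg _)).1 hnorm).symm

/-- The unit quaternions that circuits of size at most `n` implement exactly on any one qubit. -/
def reach (n : ℕ) : Set ℍ[ℝ] :=
  {q | q ∈ unitary ℍ[ℝ] ∧ ∀ (N : ℕ) (i : Fin N), HasCircuit 0 n (onQubit i (toMat q))}

theorem isWordFiltration_reach : IsWordFiltration 7 reach where
  mono m n hmn q hq := ⟨hq.1, fun N i => (hq.2 N i).mono le_rfl (by exact_mod_cast hmn)⟩
  subset_unitary n q hq := hq.1
  mul_mem {m n a b} ha hb := by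
    refine ⟨mul_mem ha.1 hb.1, fun N i => ?_⟩
    rw [map_mul, ← onQubitHom_apply, map_mul]
    exact ((ha.2 N i).mul (hb.2 N i) (hb.2 N i).mem_unitary).mono (by simp) (by simp)
  star_mem {n a} ha := by
    refine ⟨Unitary.star_mem ha.1, fun N i => ?_⟩
    rw [map_star, ← onQubitHom_apply, map_star]
    exact (ha.2 N i).star.mono le_rfl (by simp)

theorem tMatrix_pow_mul_hadamard_mul_tMatrix_pow (a b c : ℕ) :
    tMatrix ^ a * hadamardMatrix * tMatrix ^ b * hadamardMatrix * tMatrix ^ c =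
      !![(1 + zeta8 ^ b) / 2, (1 - zeta8 ^ b) / 2 * zeta8 ^ c;
        zeta8 ^ a * ((1 - zeta8 ^ b) / 2), zeta8 ^ a * ((1 + zeta8 ^ b) / 2) * zeta8 ^ c] := by
  rw [mul_assoc (tMatrix ^ a), mul_assoc (tMatrix ^ a), tMatrix_pow, tMatrix_pow, tMatrix_pow,
    hadamardMatrix_mul_diagonal_mul_hadamardMatrix]
  ext i j
  fin_cases i <;> fin_cases j <;> simp [Matrix.mul_apply, Fin.sum_univ_two]

theorem mem_iUnion_reach {q : ℍ[ℝ]} (hq : q ∈ unitary ℍ[ℝ]) (a b c : ℕ)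
    (h : tMatrix ^ a * hadamardMatrix * tMatrix ^ b * hadamardMatrix * tMatrix ^ c = toMat q) :
    q ∈ ⋃ n, reach n := by
  refine Set.mem_iUnion.2 ⟨a + 1 + b + 1 + c, hq, fun N i => ?_⟩
  have hT : ∀ n : ℕ, HasCircuit 0 n (onQubit i tMatrix ^ n) := fun n =>
    ((HasCircuit.of_gate (.phaseT i)).pow n).mono le_rfl (by simp)
  have hH : HasCircuit 0 1 (onQubit i hadamardMatrix) := HasCircuit.of_gate (.hadamard i)
  simp only [← onQubitHom_apply, ← h, map_mul, map_pow] at hT hH ⊢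
  refine (((((hT a).mul hH hH.mem_unitary).mul (hT b) (hT b).mem_unitary).mul hH
    hH.mem_unitary).mul (hT c) (hT c).mem_unitary).mono (by simp) (by simp)

theorem zeta8_pow_three : zeta8 ^ 3 = Complex.I * zeta8 := by
  rw [← zeta8_sq]
  ring

theorem zeta8_pow_six : zeta8 ^ 6 = -Complex.I := by
  rw [pow_mul zeta8 2 3, zeta8_sq, Complex.I_pow_three]

theorem zeta8_pow_seven : zeta8 ^ 7 = -Complex.I * zeta8 := by
  rw [pow_succ, zeta8_pow_six]

theorem zeta8_re : zeta8.re = √2 / 2 := by simp [zeta8_eq]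

theorem zeta8_im : zeta8.im = √2 / 2 := by simp [zeta8_eq]

theorem rotA_mem_iUnion_reach : rotA ∈ ⋃ n, reach n := by
  refine mem_iUnion_reach rotA_mem_unitary 1 7 0 ?_
  have hsq : √2 ^ 2 = 2 := Real.sq_sqrt zero_le_two
  rw [tMatrix_pow_mul_hadamard_mul_tMatrix_pow, zeta8_pow_seven, pow_one, pow_zero]
  ext i j
  fin_cases i <;> fin_cases j <;>
    simp [toMat_apply, rotA, Complex.ext_iff, zeta8_re, zeta8_im] <;> grind

theorem rotB_mem_iUnion_reach : rotB ∈ ⋃ n, reach n := by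
  refine mem_iUnion_reach rotB_mem_unitary 3 7 6 ?_
  have hsq : √2 ^ 2 = 2 := Real.sq_sqrt zero_le_two
  rw [tMatrix_pow_mul_hadamard_mul_tMatrix_pow, zeta8_pow_seven, zeta8_pow_three, zeta8_pow_six]
  ext i j
  fin_cases i <;> fin_cases j <;>
    simp [toMat_apply, rotB, Complex.ext_iff, zeta8_re, zeta8_im] <;> grind

/-- Products and adjoints of limits of exact circuits are such limits, so it suffices to reach the
two rotations of `unitary_subset_of_rotA_mem_of_rotB_mem`. -/
theorem unitary_subset_closure_reach : (unitary ℍ[ℝ] : Set ℍ[ℝ]) ⊆ closure (⋃ n, reach n) := by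
  let K : Submonoid ℍ[ℝ] :=
    { carrier := ⋃ n, reach n
      one_mem' := Set.mem_iUnion.2 ⟨0, one_mem _, fun N i => by
        rw [map_one, ← onQubitHom_apply, map_one, Nat.cast_zero]
        exact HasCircuit.one⟩
      mul_mem' := fun ha hb => by
        obtain ⟨m, hm⟩ := Set.mem_iUnion.1 ha
        obtain ⟨n, hn⟩ := Set.mem_iUnion.1 hb
        exact Set.mem_iUnion.2 ⟨_, isWordFiltration_reach.mul_mem hm hn⟩ }
  have hstar : ∀ a ∈ K.topologicalClosure, star a ∈ K.topologicalClosure := fun a ha =>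
    map_mem_closure continuous_star ha fun x hx => by
      obtain ⟨m, hm⟩ := Set.mem_iUnion.1 hx
      exact Set.mem_iUnion.2 ⟨_, isWordFiltration_reach.star_mem hm⟩
  exact unitary_subset_of_rotA_mem_of_rotB_mem K.isClosed_topologicalClosure hstar
    (subset_closure rotA_mem_iUnion_reach) (subset_closure rotB_mem_iUnion_reach)

/-- `C δ ^ (-s)` bounds the number of gates for a one-qubit rotation up to error `δ`. -/
def IsOneQubitCost (s C : ℝ) : Prop :=
  0 < C ∧ ∀ δ : ℝ, 0 < δ → δ ≤ 1 → ∀ q ∈ unitary ℍ[ℝ], ∀ (N : ℕ) (i : Fin N),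
    HasCircuit δ (C * δ ^ (-s)) (onQubit i (toMat q))

theorem exists_isOneQubitCost {s : ℝ} (hs : 0 < s) : ∃ C, IsOneQubitCost s C := by
  obtain ⟨C, hC, h⟩ :=
    isWordFiltration_reach.exists_isUnitNet_rpow unitary_subset_closure_reach hs
  refine ⟨C, hC, fun δ hδ hδ1 q hq N i => ?_⟩
  obtain ⟨n, hn, hnet⟩ := h δ hδ hδ1
  obtain ⟨a, ha, haq⟩ := hnet q hq
  have hdist : ‖onQubit i (toMat a) - onQubit i (toMat q)‖ ≤ δ := by
    rwa [← onQubitHom_apply, ← onQubitHom_apply, ← map_sub, ← map_sub, onQubitHom_apply,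
      norm_onQubit_toMat]
  exact ((ha.2 N i).of_norm_sub_le hdist).mono (by simp) hn

end OneQubit

section ZRotation

/-- The eigenvalue of `σᶻ` at the basis state `a`. -/
def spin (a : Fin 2) : ℝ := if a = 0 then 1 else -1

theorem spin_add (a b : Fin 2) : spin (a + b) = spin a * spin b := by
  fin_cases a <;> fin_cases b <;> simp [spin]

theorem abs_spin (a : Fin 2) : |spin a| = 1 := by
  fin_cases a <;> simp [spin]

variable {N : ℕ}

/-- The eigenvalue of `∏_{i ∈ I} σᶻ_i` at the basis state `x`. -/
def parity (I : Finset (Fin N)) (x : Basis N) : ℝ := ∏ i ∈ I, spin (x i)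

theorem abs_parity (I : Finset (Fin N)) (x : Basis N) : |parity I x| = 1 := by
  simp only [parity, Finset.abs_prod, abs_spin, Finset.prod_const_one]

theorem exp_ofReal_mul_I_mem_unitary (θ : ℝ) : Complex.exp (θ * Complex.I) ∈ unitary ℂ :=
  Unitary.mem_iff_star_mul_self.2 <| by
    rw [Complex.star_def, ← Complex.exp_conj, ← Complex.exp_add]
    simp

theorem diagonal_exp_mem_unitary {n : Type*} [Fintype n] [DecidableEq n] (f : n → ℝ) :
    Matrix.diagonal (fun x => Complex.exp (f x * Complex.I)) ∈ unitary (Matrix n n ℂ) := by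
  have h : star (Matrix.diagonal fun x => Complex.exp (f x * Complex.I)) *
      Matrix.diagonal (fun x => Complex.exp (f x * Complex.I)) = 1 := by
    rw [Matrix.star_eq_conjTranspose, Matrix.diagonal_conjTranspose, Matrix.diagonal_mul_diagonal,
      ← Matrix.diagonal_one]
    exact congrArg _ (funext fun x => (exp_ofReal_mul_I_mem_unitary (f x)).1)
  exact ⟨h, mul_eq_one_comm.1 h⟩

/-- The unitary `exp (iθ ∏_{i ∈ I} σᶻ_i)`. -/
noncomputable def zRot (I : Finset (Fin N)) (θ : ℝ) : Op N :=
  Matrix.diagonal fun x => Complex.exp ((θ * parity I x : ℝ) * Complex.I)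

theorem zRot_mem_unitary (I : Finset (Fin N)) (θ : ℝ) : zRot I θ ∈ unitary (Op N) :=
  diagonal_exp_mem_unitary _

theorem zRot_singleton (i : Fin N) (θ : ℝ) :
    zRot {i} θ = onQubit i (toMat (quat (Real.cos θ) 0 0 (-Real.sin θ))) := by
  have htoMat : toMat (quat (Real.cos θ) 0 0 (-Real.sin θ)) =
      Matrix.diagonal fun a => Complex.exp ((θ * spin a : ℝ) * Complex.I) := by
    ext a b
    fin_cases a <;> fin_cases b <;>
      simp [toMat_apply, spin, Complex.ext_iff, -Complex.ofReal_mul, -Complex.ofReal_neg,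
        Complex.exp_ofReal_mul_I_re, Complex.exp_ofReal_mul_I_im]
  rw [htoMat, onQubit_diagonal, zRot]
  simp only [parity, Finset.prod_singleton]

theorem parity_cnotPerm {c t : Fin N} (h : c ≠ t) {I : Finset (Fin N)} (hc : c ∉ I) (ht : t ∈ I)
    (y : Basis N) : parity I (cnotPerm h y) = parity (insert c I) y := by
  rw [parity, parity, Finset.prod_insert hc, ← Finset.mul_prod_erase _ _ ht,
    ← Finset.mul_prod_erase _ _ ht, cnotPerm_apply, Function.update_self, spin_add,
    Finset.prod_congr rfl fun j hj => by rw [Function.update_of_ne (Finset.ne_of_mem_erase hj)]]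
  ring

theorem zRot_cons {c t : Fin N} {I : Finset (Fin N)} (hc : c ∉ I) (ht : t ∈ I) (hct : c ≠ t)
    (θ : ℝ) : zRot (Finset.cons c I hc) θ =
      (Gate.cnot c t hct).toOp * zRot I θ * (Gate.cnot c t hct).toOp := by
  rw [zRot, zRot, cnot_mul_diagonal_mul_cnot]
  simp only [Function.comp_def, parity_cnotPerm hct hc ht, Finset.cons_eq_insert]

theorem IsOneQubitCost.hasCircuit_zRot {s C : ℝ} (hC : IsOneQubitCost s C) {I : Finset (Fin N)}
    (hI : I.Nonempty) {δ : ℝ} (hδ : 0 < δ) (hδ1 : δ ≤ 1) (θ : ℝ) :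
    HasCircuit δ (C * δ ^ (-s) + 2 * I.card) (zRot I θ) := by
  induction hI using Finset.Nonempty.cons_induction with
  | singleton i =>
    rw [zRot_singleton]
    exact (hC.2 δ hδ hδ1 _ (mem_unitary_quaternion_of_sum_sq (by simp)) N i).mono le_rfl (by simp)
  | cons c I hc hI ih =>
    obtain ⟨t, ht⟩ := hI
    have hct : c ≠ t := fun h => hc (h ▸ ht)
    have hgate := HasCircuit.of_gate (Gate.cnot c t hct)
    rw [zRot_cons hc ht hct]
    refine ((hgate.mul ih (zRot_mem_unitary _ _)).mul hgate hgate.mem_unitary).mono (by simp) ?_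
    rw [Finset.card_cons]
    push_cast
    linarith

end ZRotation

section Pauli

/-- The Pauli matrices `1, X, Y, Z`. -/
def pauli : Fin 4 → Matrix (Fin 2) (Fin 2) ℂ :=
  ![1, !![0, 1; 1, 0], !![0, -Complex.I; Complex.I, 0], !![1, 0; 0, -1]]

/-- A unitary that conjugates `Z` to the given Pauli matrix. -/
noncomputable def pauliFrame : Fin 4 → Matrix (Fin 2) (Fin 2) ℂ :=
  ![1, hadamardMatrix, tMatrix ^ 2 * hadamardMatrix, 1]

/-- The diagonal entries of the Pauli matrix conjugated by `pauliFrame`: those of `1` or `Z`. -/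
noncomputable def pauliSpin (p : Fin 4) : Fin 2 → ℂ := if p = 0 then 1 else fun a => spin a

theorem pauliFrame_mem_unitary (p : Fin 4) :
    pauliFrame p ∈ unitary (Matrix (Fin 2) (Fin 2) ℂ) := by
  fin_cases p
  exacts [one_mem _, hadamardMatrix_mem_unitary,
    mul_mem (pow_mem tMatrix_mem_unitary 2) hadamardMatrix_mem_unitary, one_mem _]

theorem pauli_eq_conj (p : Fin 4) :
    pauli p = pauliFrame p * Matrix.diagonal (pauliSpin p) * star (pauliFrame p) := by
  have hZ : Matrix.diagonal (fun a => (spin a : ℂ)) = !![1, 0; 0, -1] := by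
    ext i j
    fin_cases i <;> fin_cases j <;> simp [spin]
  have hX : hadamardMatrix * !![1, 0; 0, -1] * hadamardMatrix = !![0, 1; 1, 0] := by
    simpa using hadamardMatrix_mul_diagonal_mul_hadamardMatrix (-1)
  fin_cases p
  · simp [pauli, pauliFrame, pauliSpin]
  · simp [pauli, pauliFrame, pauliSpin, hZ, star_hadamardMatrix, hX]
  · have hY : pauliFrame 2 * !![1, 0; 0, -1] * star (pauliFrame 2) =
        tMatrix ^ 2 * (hadamardMatrix * !![1, 0; 0, -1] * hadamardMatrix) * star (tMatrix ^ 2) := by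
      simp [pauliFrame, star_hadamardMatrix, mul_assoc]
    simp only [Fin.reduceFinMk, pauliSpin, Fin.reduceEq, if_false, hZ, hY, hX, tMatrix_pow,
      zeta8_sq]
    ext i j
    fin_cases i <;> fin_cases j <;>
      simp [pauli, Matrix.mul_apply, Fin.sum_univ_two, Matrix.star_apply]
  · simp [pauli, pauliFrame, pauliSpin, hZ]

theorem hasCircuit_pauliFrame {N : ℕ} (i : Fin N) (p : Fin 4) :
    HasCircuit 0 3 (onQubit i (pauliFrame p)) := by
  have hone : HasCircuit 0 3 (onQubit i 1) := by
    rw [← onQubitHom_apply, map_one]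
    exact HasCircuit.one.mono le_rfl (by norm_num)
  have hH := HasCircuit.of_gate (Gate.hadamard i)
  have hT := (HasCircuit.of_gate (Gate.phaseT i)).pow 2
  fin_cases p
  · exact hone
  · exact hH.mono le_rfl (by norm_num)
  · change HasCircuit 0 3 (onQubitHom i (tMatrix ^ 2 * hadamardMatrix))
    rw [map_mul, map_pow]
    exact (hT.mul hH hH.mem_unitary).mono (by norm_num) (by norm_num)
  · exact hone

/-- The Pauli string with letters `p`. -/
def pauliString {ι : Type*} [Fintype ι] (p : ι → Fin 4) : Matrix (ι → Fin 2) (ι → Fin 2) ℂ :=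
  piKronecker fun i => pauli (p i)

variable {N : ℕ} (p : Fin N → Fin 4)

theorem diagonal_parity_eq_piKronecker :
    Matrix.diagonal (fun x => ((parity {i | p i ≠ 0} x : ℝ) : ℂ)) =
      piKronecker fun i => Matrix.diagonal (pauliSpin (p i)) := by
  rw [piKronecker_diagonal]
  congr 1
  funext x
  rw [parity, Finset.prod_filter, Complex.ofReal_prod]
  refine Finset.prod_congr rfl fun i _ => ?_
  by_cases h : p i = 0 <;> simp [pauliSpin, h]

theorem pauliString_eq_conj :
    pauliString p = piKronecker (fun i => pauliFrame (p i)) *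
      Matrix.diagonal (fun x => ((parity {i | p i ≠ 0} x : ℝ) : ℂ)) *
      star (piKronecker fun i => pauliFrame (p i)) := by
  rw [diagonal_parity_eq_piKronecker, star_piKronecker, piKronecker_mul, piKronecker_mul,
    pauliString]
  exact congrArg piKronecker (funext fun i => pauli_eq_conj (p i))

theorem piKronecker_pauliFrame_mem_unitary :
    piKronecker (fun i => pauliFrame (p i)) ∈ unitary (Op N) :=
  piKronecker_mem_unitary fun i => pauliFrame_mem_unitary (p i)

theorem exp_unitary_conj {n : Type*} [Fintype n] [DecidableEq n] {U : Matrix n n ℂ}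
    (hU : U ∈ unitary (Matrix n n ℂ)) (A : Matrix n n ℂ) :
    NormedSpace.exp (U * A * star U) = U * NormedSpace.exp A * star U :=
  Matrix.exp_units_conj (Unitary.toUnits ⟨U, hU⟩) A

theorem exp_pauliString (θ : ℝ) :
    NormedSpace.exp (((θ : ℂ) * Complex.I) • pauliString p) =
      piKronecker (fun i => pauliFrame (p i)) * zRot {i | p i ≠ 0} θ *
      star (piKronecker fun i => pauliFrame (p i)) := by
  rw [pauliString_eq_conj, ← smul_mul_assoc, ← mul_smul_comm,
    exp_unitary_conj (piKronecker_pauliFrame_mem_unitary p), ← Matrix.diagonal_smul,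
    Matrix.exp_diagonal, zRot]
  congr 3
  funext x
  rw [Pi.coe_exp, ← Complex.exp_eq_exp_ℂ, Pi.smul_apply, smul_eq_mul, Complex.ofReal_mul,
    mul_right_comm]

theorem exp_pauliString_mem_unitary (θ : ℝ) :
    NormedSpace.exp (((θ : ℂ) * Complex.I) • pauliString p) ∈ unitary (Op N) := by
  rw [exp_pauliString]
  exact mul_mem (mul_mem (piKronecker_pauliFrame_mem_unitary p) (zRot_mem_unitary _ _))
    (Unitary.star_mem (piKronecker_pauliFrame_mem_unitary p))

variable {p}

theorem IsOneQubitCost.hasCircuit_exp_pauliString {s C : ℝ} (hC : IsOneQubitCost s C) (hp : p ≠ 0)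
    {δ : ℝ} (hδ : 0 < δ) (hδ1 : δ ≤ 1) (θ : ℝ) :
    HasCircuit δ (C * δ ^ (-s) + 26 * N)
      (NormedSpace.exp (((θ : ℂ) * Complex.I) • pauliString p)) := by
  have hframe := HasCircuit.piKronecker_of_onQubit fun i => hasCircuit_pauliFrame i (p i)
  have hne : ({i | p i ≠ 0} : Finset (Fin N)).Nonempty := by
    obtain ⟨i, hi⟩ := Function.ne_iff.1 hp
    exact ⟨i, by simpa using hi⟩
  have hcard : ((Finset.card {i | p i ≠ 0} : ℕ) : ℝ) ≤ N := by
    exact_mod_cast (Finset.card_le_univ _).trans (by simp)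
  rw [exp_pauliString]
  refine ((hframe.mul (hC.hasCircuit_zRot hne hδ hδ1 θ) (zRot_mem_unitary _ _)).mul hframe.star
    hframe.star.mem_unitary).mono (by simp) ?_
  linarith

end Pauli

section Trotter

theorem norm_pow_sub_pow_le {A : Type*} [NormedRing A] [NormOneClass A]
    {a b : A} (ha : ‖a‖ ≤ 1) (hb : ‖b‖ ≤ 1) (m : ℕ) : ‖a ^ m - b ^ m‖ ≤ m * ‖a - b‖ := by
  induction m with
  | zero => simp
  | succ m ih =>
    have hbm : ‖b ^ m‖ ≤ 1 := (norm_pow_le _ _).trans (pow_le_one₀ (norm_nonneg _) hb)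
    have hsplit : a ^ (m + 1) - b ^ (m + 1) = a * (a ^ m - b ^ m) + (a - b) * b ^ m := by
      rw [pow_succ', pow_succ']
      noncomm_ring
    calc ‖a ^ (m + 1) - b ^ (m + 1)‖
        ≤ ‖a‖ * ‖a ^ m - b ^ m‖ + ‖a - b‖ * ‖b ^ m‖ := by
          rw [hsplit]
          exact (norm_add_le _ _).trans (add_le_add (norm_mul_le _ _) (norm_mul_le _ _))
      _ ≤ 1 * (m * ‖a - b‖) + ‖a - b‖ * 1 := by gcongr
      _ = (m + 1 : ℕ) * ‖a - b‖ := by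
          push_cast
          ring

theorem norm_list_sum_le {A : Type*} [SeminormedAddCommGroup A] (l : List A) :
    ‖l.sum‖ ≤ (l.map norm).sum := by
  simpa using norm_multiset_sum_le (l : Multiset A)

theorem exp_sub_one_sub_id_le_sq {σ : ℝ} (h0 : 0 ≤ σ) (h1 : σ ≤ 1) :
    Real.exp σ - 1 - σ ≤ σ ^ 2 :=
  (le_abs_self _).trans (Real.abs_exp_sub_one_sub_id_le (by rwa [abs_of_nonneg h0]))

variable {A : Type*} [NormedRing A] [NormedAlgebra ℂ A] [CompleteSpace A]

theorem exp_inv_smul_pow (x : A) {m : ℕ} (hm : m ≠ 0) :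
    NormedSpace.exp ((m : ℂ)⁻¹ • x) ^ m = NormedSpace.exp x := by
  let _ : NormedAlgebra ℚ A := NormedAlgebra.restrictScalars ℚ ℂ A
  rw [← NormedSpace.exp_nsmul, ← Nat.cast_smul_eq_nsmul ℂ, smul_smul,
    mul_inv_cancel₀ (by exact_mod_cast hm), one_smul]

variable [NormOneClass A]

theorem norm_exp_sub_one_sub_le (x : A) :
    ‖NormedSpace.exp x - 1 - x‖ ≤ Real.exp ‖x‖ - 1 - ‖x‖ := by
  have hx := NormedSpace.exp_series_hasSum_exp' (𝕂 := ℂ) x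
  have hnorm := NormedSpace.exp_series_hasSum_exp' (𝕂 := ℝ) ‖x‖
  rw [← Real.exp_eq_exp_ℝ] at hnorm
  have hle := ((hasSum_nat_add_iff' 2).2 hx).norm_le_of_bounded ((hasSum_nat_add_iff' 2).2 hnorm)
    fun n => by
      rw [norm_smul, norm_inv, Complex.norm_natCast, smul_eq_mul]
      gcongr
      exact norm_pow_le _ _
  simpa [Finset.sum_range_succ, sub_sub] using hle

theorem norm_prod_exp_sub_one_sub_le (l : List A) :
    ‖(l.map NormedSpace.exp).prod - 1 - l.sum‖ ≤
      Real.exp (l.map norm).sum - 1 - (l.map norm).sum := by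
  induction l with
  | nil => simp
  | cons x l ih =>
    simp only [List.map_cons, List.prod_cons, List.sum_cons]
    set P := (l.map NormedSpace.exp).prod
    set σ := (l.map norm).sum
    have hx := norm_exp_sub_one_sub_le x
    have hx0 : 0 ≤ Real.exp ‖x‖ - 1 - ‖x‖ := (norm_nonneg _).trans hx
    have hP1 : ‖P - 1‖ ≤ Real.exp σ - 1 := by
      have := norm_le_norm_sub_add (P - 1) l.sum
      linarith [norm_list_sum_le l]
    have hP : ‖P‖ ≤ Real.exp σ := by
      have := norm_le_norm_sub_add P 1
      rw [norm_one] at this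
      linarith
    have hsplit : NormedSpace.exp x * P - 1 - (x + l.sum) =
        (NormedSpace.exp x - 1 - x) * P + x * (P - 1) + (P - 1 - l.sum) := by noncomm_ring
    calc ‖NormedSpace.exp x * P - 1 - (x + l.sum)‖
        ≤ ‖NormedSpace.exp x - 1 - x‖ * ‖P‖ + ‖x‖ * ‖P - 1‖ + ‖P - 1 - l.sum‖ := by
          rw [hsplit]
          exact norm_add₃_le.trans (by gcongr <;> exact norm_mul_le _ _)
      _ ≤ (Real.exp ‖x‖ - 1 - ‖x‖) * Real.exp σ + ‖x‖ * (Real.exp σ - 1) +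
          (Real.exp σ - 1 - σ) := by gcongr
      _ = Real.exp (‖x‖ + σ) - 1 - (‖x‖ + σ) := by
          rw [Real.exp_add]
          ring

theorem norm_prod_exp_sub_exp_sum_le {l : List A} {s : ℝ} (hs : (l.map norm).sum ≤ s)
    (hs1 : s ≤ 1) :
    ‖(l.map NormedSpace.exp).prod - NormedSpace.exp l.sum‖ ≤ 2 * s ^ 2 := by
  have hσ0 : 0 ≤ (l.map norm).sum := List.sum_nonneg (by simp)
  have hsum : ‖l.sum‖ ≤ s := (norm_list_sum_le l).trans hs
  have hprod : ‖(l.map NormedSpace.exp).prod - 1 - l.sum‖ ≤ s ^ 2 :=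
    (norm_prod_exp_sub_one_sub_le l).trans
      ((exp_sub_one_sub_id_le_sq hσ0 (hs.trans hs1)).trans (by gcongr))
  have hexp : ‖NormedSpace.exp l.sum - 1 - l.sum‖ ≤ s ^ 2 :=
    (norm_exp_sub_one_sub_le l.sum).trans
      ((exp_sub_one_sub_id_le_sq (norm_nonneg _) (hsum.trans hs1)).trans (by gcongr))
  calc ‖(l.map NormedSpace.exp).prod - NormedSpace.exp l.sum‖
      = ‖((l.map NormedSpace.exp).prod - 1 - l.sum) - (NormedSpace.exp l.sum - 1 - l.sum)‖ := by
        congr 1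
        abel
    _ ≤ s ^ 2 + s ^ 2 := (norm_sub_le _ _).trans (add_le_add hprod hexp)
    _ = 2 * s ^ 2 := (two_mul _).symm

theorem norm_trotter_sub_le {l : List A} {s : ℝ} (hs : (l.map norm).sum ≤ s) {m : ℕ} (hm : m ≠ 0)
    (hsm : s ≤ m) (hl : ∀ x ∈ l, ‖NormedSpace.exp ((m : ℂ)⁻¹ • x)‖ ≤ 1)
    (hsum : ‖NormedSpace.exp ((m : ℂ)⁻¹ • l.sum)‖ ≤ 1) :
    ‖(l.map fun x => NormedSpace.exp ((m : ℂ)⁻¹ • x)).prod ^ m - NormedSpace.exp l.sum‖ ≤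
      2 * s ^ 2 / m := by
  have hm0 : (0 : ℝ) < m := by positivity
  have hnorm : ((l.map fun x => (m : ℂ)⁻¹ • x).map norm).sum ≤ s / m := by
    have : ((l.map fun x => (m : ℂ)⁻¹ • x).map norm).sum = (m : ℝ)⁻¹ * (l.map norm).sum := by
      simp only [List.map_map, Function.comp_def, norm_smul, norm_inv, Complex.norm_natCast,
        List.sum_map_mul_left]
    rw [this, div_eq_inv_mul]
    gcongr
  have hprod : ‖(l.map fun x => NormedSpace.exp ((m : ℂ)⁻¹ • x)).prod‖ ≤ 1 := by
    rw [← Submonoid.mem_unitClosedBall]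
    refine Submonoid.list_prod_mem _ fun y hy => ?_
    obtain ⟨x, hx, rfl⟩ := List.mem_map.1 hy
    exact (Submonoid.mem_unitClosedBall A).2 (hl x hx)
  have hstep := norm_prod_exp_sub_exp_sum_le hnorm ((div_le_one hm0).2 hsm)
  rw [List.map_map, ← List.smul_sum] at hstep
  calc ‖(l.map fun x => NormedSpace.exp ((m : ℂ)⁻¹ • x)).prod ^ m - NormedSpace.exp l.sum‖
      ≤ m * (2 * (s / m) ^ 2) := by
        rw [← exp_inv_smul_pow l.sum hm]
        exact (norm_pow_sub_pow_le hprod hsum m).trans (by gcongr; exact hstep)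
    _ = 2 * s ^ 2 / m := by field_simp

end Trotter

section Matrix

variable {n : Type*} [Fintype n] [DecidableEq n]

theorem norm_entry_le_l2_opNorm (M : Matrix n n ℂ) (x y : n) : ‖M x y‖ ≤ ‖M‖ := by
  have h := Matrix.l2_opNorm_mulVec M (EuclideanSpace.single y 1)
  rw [PiLp.norm_single, norm_one, mul_one] at h
  simpa using (PiLp.norm_apply_le _ x).trans h

theorem norm_trace_le_card_mul_l2_opNorm (M : Matrix n n ℂ) :
    ‖M.trace‖ ≤ Fintype.card n * ‖M‖ := by
  calc ‖M.trace‖ ≤ ∑ x, ‖M x x‖ := norm_sum_le _ _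
    _ ≤ ∑ _x : n, ‖M‖ := Finset.sum_le_sum fun x _ => norm_entry_le_l2_opNorm M x x
    _ = Fintype.card n * ‖M‖ := by simp

theorem exists_isSelfAdjoint_exp_I_smul_eq {U : Matrix n n ℂ} (hU : U ∈ unitary (Matrix n n ℂ)) :
    ∃ M : Matrix n n ℂ, IsSelfAdjoint M ∧ ‖M‖ ≤ Real.pi ∧
      NormedSpace.exp (Complex.I • M) = U := by
  have hcont : ∀ f : ℂ → ℂ, ContinuousOn f (spectrum ℂ U) := fun f =>
    (Matrix.finite_spectrum U).continuousOn _
  have : IsStarNormal U := ⟨by rw [commute_iff_eq, hU.1, hU.2]⟩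
  refine ⟨cfc (fun z : ℂ => (z.arg : ℂ)) U, IsSelfAdjoint.cfc_arg U,
    norm_cfc_le Real.pi_nonneg fun y _ => by simpa using Complex.abs_arg_le_pi y, ?_⟩
  rw [← CFC.exp_eq_normedSpace_exp (𝕜 := ℂ), ← cfc_const_mul _ _ _ (hcont _),
    ← cfc_comp' (hg := NormedSpace.exp_continuous.continuousOn) (hf := hcont _)]
  conv_rhs => rw [← cfc_id' ℂ U]
  refine cfc_congr fun y hy => ?_
  have hy1 : ‖y‖ = 1 := spectrum.norm_eq_one_of_unitary hU hy
  have hy0 : y ≠ 0 := norm_ne_zero_iff.1 (hy1.trans_ne one_ne_zero)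
  have hlog : Complex.I * y.arg = Complex.log y :=
    Complex.ext (by simp [Complex.log_re, hy1]) (by simp [Complex.log_im])
  simp only [hlog, ← Complex.exp_eq_exp_ℂ, Complex.exp_log hy0]

end Matrix

section PauliExpansion

variable {ι : Type*} [Fintype ι]

theorem star_pauli (p : Fin 4) : star (pauli p) = pauli p := by
  fin_cases p <;> ext i j <;> fin_cases i <;> fin_cases j <;> simp [pauli, Matrix.star_apply]

theorem star_pauliString (p : ι → Fin 4) : star (pauliString p) = pauliString p := by
  rw [pauliString, star_piKronecker]
  exact congrArg piKronecker (funext fun i => star_pauli (p i))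

variable [DecidableEq ι]

theorem pauli_mul_self (p : Fin 4) : pauli p * pauli p = 1 := by
  fin_cases p <;> ext i j <;> fin_cases i <;> fin_cases j <;>
    simp [pauli, Matrix.mul_apply, Fin.sum_univ_two]

theorem sum_pauli_mul_pauli (a b c d : Fin 2) :
    ∑ p, pauli p a b * pauli p c d = if a = d ∧ b = c then 2 else 0 := by
  fin_cases a <;> fin_cases b <;> fin_cases c <;> fin_cases d <;>
    simp [Fin.sum_univ_four, pauli] <;> norm_num

theorem pauliString_mem_unitary (p : ι → Fin 4) :
    pauliString p ∈ unitary (Matrix (ι → Fin 2) (ι → Fin 2) ℂ) :=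
  piKronecker_mem_unitary fun i => by
    rw [Unitary.mem_iff, star_pauli, pauli_mul_self]
    exact ⟨rfl, rfl⟩

theorem sum_pauliString_mul_pauliString (x y z w : ι → Fin 2) :
    ∑ p : ι → Fin 4, pauliString p x y * pauliString p z w =
      if x = w ∧ y = z then 2 ^ Fintype.card ι else 0 := by
  have hprod := Finset.prod_univ_sum (fun _ : ι => (Finset.univ : Finset (Fin 4)))
    fun i p => pauli p (x i) (y i) * pauli p (z i) (w i)
  simp only [Fintype.piFinset_univ, sum_pauli_mul_pauli, Fintype.prod_ite_zero] at hprod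
  simp only [pauliString, piKronecker, Matrix.of_apply, ← Finset.prod_mul_distrib, ← hprod]
  simp [funext_iff, forall_and]

/-- The coefficient of a Pauli string in the Pauli expansion of `M`. -/
noncomputable def pauliCoeff (M : Matrix (ι → Fin 2) (ι → Fin 2) ℂ) (p : ι → Fin 4) : ℂ :=
  (2 ^ Fintype.card ι)⁻¹ * (pauliString p * M).trace

variable {M : Matrix (ι → Fin 2) (ι → Fin 2) ℂ}

theorem norm_pauliCoeff_le (p : ι → Fin 4) : ‖pauliCoeff M p‖ ≤ ‖M‖ := by
  have htrace := norm_trace_le_card_mul_l2_opNorm (pauliString p * M)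
  rw [CStarRing.norm_mem_unitary_mul _ (pauliString_mem_unitary p)] at htrace
  rw [pauliCoeff, norm_mul, norm_inv, norm_pow, Complex.norm_ofNat, inv_mul_le_iff₀ (by positivity)]
  simpa using htrace

theorem star_pauliCoeff (hM : IsSelfAdjoint M) (p : ι → Fin 4) :
    star (pauliCoeff M p) = pauliCoeff M p := by
  have htrace : star (pauliString p * M).trace = (pauliString p * M).trace := by
    rw [← Matrix.trace_conjTranspose, ← Matrix.star_eq_conjTranspose, star_mul, hM.star_eq,
      star_pauliString, Matrix.trace_mul_comm]
  rw [pauliCoeff, star_mul', htrace]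
  simp

theorem sum_pauliCoeff_smul_pauliString : ∑ p, pauliCoeff M p • pauliString p = M := by
  ext x y
  calc (∑ p, pauliCoeff M p • pauliString p) x y
      = (2 ^ Fintype.card ι)⁻¹ * ∑ z, ∑ w,
          (∑ p : ι → Fin 4, pauliString p x y * pauliString p z w) * M w z := by
        simp only [Matrix.sum_apply, Matrix.smul_apply, smul_eq_mul, pauliCoeff, Matrix.trace,
          Matrix.diag_apply, Matrix.mul_apply, Finset.mul_sum, Finset.sum_mul]
        rw [Finset.sum_comm]
        refine Finset.sum_congr rfl fun z _ => ?_
        rw [Finset.sum_comm]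
        exact Finset.sum_congr rfl fun w _ => Finset.sum_congr rfl fun p _ => by ring
    _ = M x y := by
        simp [sum_pauliString_mul_pauliString, ite_and]

theorem exists_real_pauli_expansion (hM : IsSelfAdjoint M) :
    ∃ a : (ι → Fin 4) → ℝ, (∀ p, |a p| ≤ ‖M‖) ∧ ∑ p, (a p : ℂ) • pauliString p = M := by
  refine ⟨fun p => (pauliCoeff M p).re,
    fun p => (Complex.abs_re_le_norm _).trans (norm_pauliCoeff_le p), ?_⟩
  have hreal : ∀ p, ((pauliCoeff M p).re : ℂ) = pauliCoeff M p := fun p =>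
    Complex.conj_eq_iff_re.1 (star_pauliCoeff hM p)
  simp only [hreal, sum_pauliCoeff_smul_pauliString]

end PauliExpansion

section PauliEvolution

variable {N : ℕ} {κ : Type*} (A : Finset κ) (p : κ → Fin N → Fin 4) (a : κ → ℝ)

theorem sum_smul_pauliString_mem_skewAdjoint :
    ∑ i ∈ A, ((a i : ℂ) * Complex.I) • pauliString (p i) ∈ skewAdjoint (Op N) :=
  sum_mem fun i _ => by
    rw [skewAdjoint.mem_iff, star_smul, star_pauliString, ← neg_smul]
    simp

theorem exp_sum_smul_pauliString_mem_unitary :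
    NormedSpace.exp (∑ i ∈ A, ((a i : ℂ) * Complex.I) • pauliString (p i)) ∈ unitary (Op N) :=
  let _ : NormedAlgebra ℚ (Op N) := NormedAlgebra.restrictScalars ℚ ℂ _
  NormedSpace.exp_mem_unitary_of_mem_skewAdjoint (sum_smul_pauliString_mem_skewAdjoint A p a)

theorem norm_smul_pauliString (θ : ℝ) (r : Fin N → Fin 4) :
    ‖((θ : ℂ) * Complex.I) • pauliString r‖ = |θ| := by
  rw [norm_smul, CStarRing.norm_of_mem_unitary (pauliString_mem_unitary r), norm_mul,
    Complex.norm_I, Complex.norm_real, Real.norm_eq_abs, mul_one, mul_one]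

theorem inv_natCast_smul_smul_pauliString (m : ℕ) (θ : ℝ) (r : Fin N → Fin 4) :
    (m : ℂ)⁻¹ • ((θ : ℂ) * Complex.I) • pauliString r =
      (((θ / m : ℝ) : ℂ) * Complex.I) • pauliString r := by
  rw [smul_smul]
  congr 1
  push_cast
  ring

theorem norm_trotter_pauliString_sub_le {s : ℝ} (hs : ∑ i ∈ A, |a i| ≤ s) {m : ℕ} (hm : m ≠ 0)
    (hsm : s ≤ m) :
    ‖(A.toList.map fun i =>
          NormedSpace.exp ((((a i / m : ℝ) : ℂ) * Complex.I) • pauliString (p i))).prod ^ m -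
        NormedSpace.exp (∑ i ∈ A, ((a i : ℂ) * Complex.I) • pauliString (p i))‖ ≤
      2 * s ^ 2 / m := by
  have htrotter := norm_trotter_sub_le
    (l := A.toList.map fun i => ((a i : ℂ) * Complex.I) • pauliString (p i)) (s := s)
  simp only [List.map_map, Function.comp_def, Finset.sum_map_toList, norm_smul_pauliString,
    List.forall_mem_map, inv_natCast_smul_smul_pauliString, Finset.smul_sum] at htrotter
  exact htrotter hs hm hsm
    (fun i _ => (CStarRing.norm_of_mem_unitary (exp_pauliString_mem_unitary _ _)).le)
    (CStarRing.norm_of_mem_unitary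
      (exp_sum_smul_pauliString_mem_unitary A p fun i => a i / m)).le

variable {A p a} {C : ℝ}

theorem IsOneQubitCost.hasCircuit_trotter_pauliString (hC : IsOneQubitCost 1 C)
    (hp : ∀ i ∈ A, p i ≠ 0) {δ : ℝ} (hδ : 0 < δ) (hδ1 : δ ≤ 1) (m : ℕ) :
    HasCircuit (m * (A.card * δ)) (m * (A.card * (C / δ + 26 * N)))
      ((A.toList.map fun i =>
        NormedSpace.exp (((a i : ℂ) * Complex.I) • pauliString (p i))).prod ^ m) := by
  set l := A.toList.map fun i => NormedSpace.exp (((a i : ℂ) * Complex.I) • pauliString (p i))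
  have hunitary : ∀ W ∈ l, W ∈ unitary (Op N) :=
    List.forall_mem_map.2 fun i _ => exp_pauliString_mem_unitary _ _
  have hcircuit : ∀ W ∈ l, HasCircuit δ (C / δ + 26 * N) W :=
    List.forall_mem_map.2 fun i hi => by
      simpa only [Real.rpow_neg_one, ← div_eq_mul_inv] using
        hC.hasCircuit_exp_pauliString (hp i (Finset.mem_toList.1 hi)) hδ hδ1 (a i)
  have hprod := HasCircuit.list_prod l hcircuit hunitary
  rw [List.length_map, Finset.length_toList] at hprod
  have hpow := HasCircuit.list_prod (List.replicate m l.prod)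
    (fun W hW => List.eq_of_mem_replicate hW ▸ hprod)
    (fun W hW => List.eq_of_mem_replicate hW ▸ Submonoid.list_prod_mem _ hunitary)
  rwa [List.prod_replicate, List.length_replicate] at hpow

theorem IsOneQubitCost.hasCircuit_exp_sum_pauliString (hC : IsOneQubitCost 1 C)
    (hp : ∀ i ∈ A, p i ≠ 0) {s : ℝ} (hs1 : 1 ≤ s) (hA : A.card ≤ s) (hs : ∑ i ∈ A, |a i| ≤ s)
    {δ : ℝ} (hδ : 0 < δ) (hδ1 : δ ≤ 1) :
    HasCircuit δ (130 * (C + N) * s ^ 6 / δ ^ 3)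
      (NormedSpace.exp (∑ i ∈ A, ((a i : ℂ) * Complex.I) • pauliString (p i))) := by
  have hC0 := hC.1
  set m := ⌈4 * s ^ 2 / δ⌉₊
  have hm_ge : 4 * s ^ 2 / δ ≤ m := Nat.le_ceil _
  have hm_le : (m : ℝ) ≤ 5 * s ^ 2 / δ := by
    have hone : 1 ≤ s ^ 2 / δ := (one_le_div hδ).2 (hδ1.trans (one_le_pow₀ hs1))
    calc (m : ℝ) ≤ 4 * s ^ 2 / δ + 1 := (Nat.ceil_lt_add_one (by positivity)).le
      _ ≤ 4 * s ^ 2 / δ + s ^ 2 / δ := by gcongr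
      _ = 5 * s ^ 2 / δ := by ring
  have hsm : s ≤ m := by
    refine le_trans ?_ hm_ge
    rw [le_div_iff₀ hδ]
    nlinarith
  have hm0 : (0 : ℝ) < m := by linarith
  have hδ' : 0 < δ / (2 * m * s) := by positivity
  have hδ'_le : δ / (2 * m * s) ≤ 1 := by
    rw [div_le_one (by positivity)]
    nlinarith
  refine ((hC.hasCircuit_trotter_pauliString hp hδ' hδ'_le m).of_norm_sub_le
    (norm_trotter_pauliString_sub_le A p a hs (by exact_mod_cast hm0.ne') hsm)).mono ?_ ?_
  · have hgates : m * (A.card * (δ / (2 * m * s))) ≤ δ / 2 := by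
      calc m * (A.card * (δ / (2 * m * s))) ≤ m * (s * (δ / (2 * m * s))) := by gcongr
        _ = δ / 2 := by field_simp
    have htrotter : 2 * s ^ 2 / m ≤ δ / 2 := by
      rw [div_le_iff₀ hδ] at hm_ge
      rw [div_le_iff₀ hm0]
      linarith
    linarith
  · calc m * (A.card * (C / (δ / (2 * m * s)) + 26 * N))
        ≤ m * (s * (C / (δ / (2 * m * s)) + 26 * N)) := by gcongr
      _ = m * s * (2 * (m * s) * C / δ + 26 * N * 1) := by
          field_simp
      _ ≤ (5 * s ^ 2 / δ) * s * (2 * ((5 * s ^ 2 / δ) * s) * C / δ + 26 * N * (s ^ 3 / δ ^ 2)) := by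
          gcongr
          exact (one_le_div (by positivity)).2 ((pow_le_one₀ hδ.le hδ1).trans (one_le_pow₀ hs1))
      _ = (50 * C + 130 * N) * s ^ 6 / δ ^ 3 := by
          field_simp
          ring
      _ ≤ 130 * (C + N) * s ^ 6 / δ ^ 3 := by
          gcongr
          linarith

end PauliEvolution

section Embedding

variable {N : ℕ} (S : Finset (Fin N))

/-- The operator `B ⊗ 𝟙`, for `B` acting on the spins in `S`. -/
def embed (B : Matrix (S → Fin 2) (S → Fin 2) ℂ) : Op N :=
  Matrix.of fun x y => if ∀ i, i ∉ S → x i = y i then B (fun i => x i) (fun i => y i) else 0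

theorem actsOn_iff_exists_embed {A : Op N} : ActsOn S A ↔ ∃ B, embed S B = A :=
  exists_congr fun _ => by simp only [← Matrix.ext_iff, embed, Matrix.of_apply, eq_comm]

theorem embed_eq_kronecker (B : Matrix (S → Fin 2) (S → Fin 2) ℂ) :
    embed S B = (Matrix.kroneckerMap (· * ·) B
      (1 : Matrix ({i // i ∉ S} → Fin 2) ({i // i ∉ S} → Fin 2) ℂ)).submatrix
        (Equiv.piEquivPiSubtypeProd (· ∈ S) fun _ => Fin 2)
        (Equiv.piEquivPiSubtypeProd (· ∈ S) fun _ => Fin 2) := by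
  ext x y
  simp only [embed, Matrix.of_apply, Matrix.submatrix_apply, Matrix.kroneckerMap_apply,
    Equiv.piEquivPiSubtypeProd_apply, Matrix.one_apply, funext_iff, Subtype.forall]
  split_ifs <;> simp

theorem embed_one : embed S 1 = 1 := by
  rw [embed_eq_kronecker, Matrix.one_kronecker_one, Matrix.submatrix_one_equiv]

/-- `embed S` as a homomorphism of star algebras. -/
def embedHom : Matrix (S → Fin 2) (S → Fin 2) ℂ →⋆ₐ[ℂ] Op N where
  toFun := embed S
  map_one' := embed_one S
  map_mul' B B' := by
    simp only [embed_eq_kronecker]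
    rw [Matrix.submatrix_mul_equiv, ← Matrix.mul_kronecker_mul, one_mul]
  map_zero' := by
    ext x y
    simp [embed]
  map_add' B B' := by
    ext x y
    simp only [embed, Matrix.of_apply, Matrix.add_apply]
    split_ifs <;> simp
  commutes' c := by
    rw [Algebra.algebraMap_eq_smul_one, Algebra.algebraMap_eq_smul_one, ← embed_one S]
    ext x y
    simp only [embed, Matrix.of_apply, Matrix.smul_apply]
    split_ifs <;> simp
  map_star' B := by
    simp only [embed_eq_kronecker, Matrix.star_eq_conjTranspose, Matrix.conjTranspose_submatrix,
      Matrix.conjTranspose_kronecker, Matrix.conjTranspose_one]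

theorem embedHom_apply (B : Matrix (S → Fin 2) (S → Fin 2) ℂ) : embedHom S B = embed S B := rfl

theorem embedHom_injective : Function.Injective (embedHom S) := by
  intro B B' h
  ext a b
  have hentry := congrFun₂ h (fun i => if hi : i ∈ S then a ⟨i, hi⟩ else 0)
    fun i => if hi : i ∈ S then b ⟨i, hi⟩ else 0
  have hoff : ∀ i, i ∉ S → (if hi : i ∈ S then a ⟨i, hi⟩ else 0) =
      (if hi : i ∈ S then b ⟨i, hi⟩ else 0) := fun i hi => by simp [hi]
  simp only [embedHom_apply, embed, Matrix.of_apply, if_pos hoff] at hentry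
  simpa using hentry

theorem mem_unitary_of_embedHom_mem_unitary {B : Matrix (S → Fin 2) (S → Fin 2) ℂ}
    (h : embedHom S B ∈ unitary (Op N)) : B ∈ unitary (Matrix (S → Fin 2) (S → Fin 2) ℂ) := by
  rw [Unitary.mem_iff, ← map_star, ← map_mul, ← map_mul, ← map_one (embedHom S)] at h
  exact Unitary.mem_iff.2 ⟨embedHom_injective S h.1, embedHom_injective S h.2⟩

/-- The extension by identities of a Pauli string on the spins in `S`. -/
def extendString (p : S → Fin 4) : Fin N → Fin 4 := fun i => if hi : i ∈ S then p ⟨i, hi⟩ else 0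

theorem extendString_ne_zero {p : S → Fin 4} (hp : p ≠ 0) : extendString S p ≠ 0 := by
  obtain ⟨i, hi⟩ := Function.ne_iff.1 hp
  exact Function.ne_iff.2 ⟨i, by simpa [extendString] using hi⟩

theorem embedHom_pauliString (p : S → Fin 4) :
    embedHom S (pauliString p) = pauliString (extendString S p) := by
  ext x y
  have hmem : ∀ i : {i // i ∈ S},
      pauli (extendString S p i) (x i) (y i) = pauli (p i) (x i) (y i) := by
    rintro ⟨i, hi⟩
    simp [extendString, hi]
  have hnotMem : ∀ i : {i // i ∉ S},
      pauli (extendString S p i) (x i) (y i) = if x i = y i then 1 else 0 := by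
    rintro ⟨i, hi⟩
    simp [extendString, hi, pauli, Matrix.one_apply]
  simp only [embedHom_apply, embed, pauliString, piKronecker, Matrix.of_apply]
  rw [← Fintype.prod_subtype_mul_prod_subtype (· ∈ S), Finset.prod_congr rfl fun i _ => hmem i,
    Finset.prod_congr rfl fun i _ => hnotMem i, Fintype.prod_ite_zero]
  simp only [Subtype.forall, Finset.prod_const_one, mul_ite, mul_one, mul_zero]
  split_ifs
  · congr!
  · rfl

theorem pauliString_zero {ι : Type*} [Fintype ι] :
    pauliString (0 : ι → Fin 4) = 1 :=
  piKronecker_one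

theorem exists_smul_eq_exp_sum_pauliString {V : Op N} (hV : V ∈ unitary (Op N))
    (hS : ActsOn S V) :
    ∃ c ∈ unitary ℂ, ∃ a : (S → Fin 4) → ℝ, (∀ p, |a p| ≤ 4) ∧
      c • V = NormedSpace.exp (∑ p ∈ Finset.univ.erase 0,
        ((a p : ℂ) * Complex.I) • pauliString (extendString S p)) := by
  obtain ⟨B, rfl⟩ := (actsOn_iff_exists_embed S).1 hS
  obtain ⟨M, hM, hMπ, hMexp⟩ :=
    exists_isSelfAdjoint_exp_I_smul_eq (mem_unitary_of_embedHom_mem_unitary S hV)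
  obtain ⟨a, ha, haM⟩ := exists_real_pauli_expansion hM
  refine ⟨Complex.exp (-(a 0 * Complex.I)), ?_, a,
    fun p => (ha p).trans (hMπ.trans Real.pi_le_four), ?_⟩
  · rw [← neg_mul, ← Complex.ofReal_neg]
    exact exp_ofReal_mul_I_mem_unitary (-a 0)
  let _ : NormedAlgebra ℚ (Op N) := NormedAlgebra.restrictScalars ℚ ℂ _
  let _ : NormedAlgebra ℚ (Matrix (S → Fin 2) (S → Fin 2) ℂ) :=
    NormedAlgebra.restrictScalars ℚ ℂ _
  have hcont : Continuous (embedHom S) :=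
    (embedHom S).toAlgHom.toLinearMap.continuous_of_finiteDimensional
  have hexp : embed S B = NormedSpace.exp (embedHom S (Complex.I • M)) := by
    rw [← hMexp, ← embedHom_apply]
    exact NormedSpace.map_exp (embedHom S) hcont _
  have hsum : embedHom S (Complex.I • M) = algebraMap ℂ (Op N) (a 0 * Complex.I) +
      ∑ p ∈ Finset.univ.erase 0, ((a p : ℂ) * Complex.I) • pauliString (extendString S p) := by
    rw [← haM, map_smul, map_sum, ← Finset.add_sum_erase _ _ (Finset.mem_univ 0), smul_add,
      Finset.smul_sum, pauliString_zero, map_smul, map_one, smul_smul,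
      Algebra.algebraMap_eq_smul_one, mul_comm Complex.I]
    refine congrArg₂ _ rfl (Finset.sum_congr rfl fun p _ => ?_)
    rw [map_smul, smul_smul, embedHom_pauliString, mul_comm]
  rw [hexp, hsum, NormedSpace.exp_add_of_commute (Algebra.commutes _ _),
    ← NormedSpace.algebraMap_exp_comm, Algebra.algebraMap_eq_smul_one, smul_mul_assoc, one_mul,
    smul_smul, ← Complex.exp_eq_exp_ℂ, ← Complex.exp_add, neg_add_cancel, Complex.exp_zero,
    one_smul]

end Embedding

section UpToPhase

variable {N : ℕ} {δ δ' L L' : ℝ} {W W' : Op N}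

/-- Some multiple of `W` by a phase is approximated up to error `δ` by a circuit with at most `L`
gates. The gate set only generates finitely many global phases, but phases cancel in
`U * D * star U`. -/
def HasCircuitUpToPhase (δ L : ℝ) (W : Op N) : Prop := ∃ c ∈ unitary ℂ, HasCircuit δ L (c • W)

namespace HasCircuitUpToPhase

theorem mono (h : HasCircuitUpToPhase δ L W) (hδ : δ ≤ δ') (hL : L ≤ L') :
    HasCircuitUpToPhase δ' L' W :=
  h.imp fun _ => And.imp_right fun h => h.mono hδ hL

theorem one : HasCircuitUpToPhase 0 0 (1 : Op N) := ⟨1, one_mem _, by simpa using HasCircuit.one⟩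

theorem mul (h : HasCircuitUpToPhase δ L W) (h' : HasCircuitUpToPhase δ' L' W')
    (hW' : W' ∈ unitary (Op N)) : HasCircuitUpToPhase (δ + δ') (L + L') (W * W') := by
  obtain ⟨c, hc, h⟩ := h
  obtain ⟨c', hc', h'⟩ := h'
  refine ⟨c * c', mul_mem hc hc', ?_⟩
  rw [← smul_mul_smul_comm]
  exact h.mul h' (Unitary.smul_mem_of_mem hc' hW')

theorem of_norm_sub_le (h : HasCircuitUpToPhase δ L W) (hW : ‖W - W'‖ ≤ δ') :
    HasCircuitUpToPhase (δ + δ') L W' := by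
  obtain ⟨c, hc, h⟩ := h
  refine ⟨c, hc, h.of_norm_sub_le ?_⟩
  rwa [← smul_sub, norm_smul, CStarRing.norm_of_mem_unitary hc, one_mul]

theorem list_prod (l : List (Op N)) (h : ∀ W ∈ l, HasCircuitUpToPhase δ L W)
    (hl : ∀ W ∈ l, W ∈ unitary (Op N)) :
    HasCircuitUpToPhase (l.length * δ) (l.length * L) l.prod := by
  induction l with
  | nil => simpa using one
  | cons W l ih =>
    rw [List.forall_mem_cons] at h hl
    refine (h.1.mul (ih h.2 hl.2) (Submonoid.list_prod_mem _ hl.2)).mono ?_ ?_ <;>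
      push_cast [List.length_cons] <;> linarith

end HasCircuitUpToPhase

theorem IsOneQubitCost.hasCircuitUpToPhase_of_actsOn {C : ℝ} (hC : IsOneQubitCost 1 C)
    {S : Finset (Fin N)} {V : Op N} (hV : V ∈ unitary (Op N)) (hS : ActsOn S V) (hδ : 0 < δ)
    (hδ1 : δ ≤ 1) :
    HasCircuitUpToPhase δ (130 * (C + N) * (4 * 4 ^ S.card) ^ 6 / δ ^ 3) V := by
  obtain ⟨c, hc, a, ha, hexp⟩ := exists_smul_eq_exp_sum_pauliString S hV hS
  have hcard : (((Finset.univ.erase (0 : S → Fin 4)).card : ℕ) : ℝ) ≤ 4 ^ S.card := by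
    exact_mod_cast (Finset.card_le_univ _).trans (by simp)
  have hpow : (1 : ℝ) ≤ 4 ^ S.card := one_le_pow₀ (by norm_num)
  refine ⟨c, hc, hexp ▸ hC.hasCircuit_exp_sum_pauliString
    (fun p hp => extendString_ne_zero S (Finset.ne_of_mem_erase hp)) (by linarith)
    (by linarith) ?_ hδ hδ1⟩
  calc ∑ p ∈ Finset.univ.erase 0, |a p| ≤ (Finset.univ.erase (0 : S → Fin 4)).card • 4 :=
        Finset.sum_le_card_nsmul _ _ _ fun p _ => ha p
    _ ≤ 4 * 4 ^ S.card := by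
        rw [nsmul_eq_mul]
        linarith

end UpToPhase

section Quasilocal

theorem exists_pow_le_rpow_logb {b g X : ℝ} (hb : 1 < b) (hg : 1 ≤ g) (hX : 1 ≤ X) :
    ∃ r : ℕ, X ≤ b ^ r ∧ g ^ r ≤ g * X ^ Real.logb b g := by
  obtain ⟨n, hn, hn'⟩ := exists_nat_pow_near hX hb
  have hb0 : 0 < b := by linarith
  have hg0 : 0 < g := by linarith
  refine ⟨n + 1, hn'.le, ?_⟩
  calc g ^ (n + 1) = g * (b ^ Real.logb b g) ^ n := by
        rw [Real.rpow_logb hb0 hb.ne' hg0, pow_succ']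
    _ = g * (b ^ n) ^ Real.logb b g := by
        rw [← Real.rpow_mul_natCast hb0.le, mul_comm _ (n : ℝ), Real.rpow_natCast_mul hb0.le]
    _ ≤ g * X ^ Real.logb b g := by
        have := Real.logb_nonneg hb hg
        gcongr

theorem card_filter_val_le {N : ℕ} (a b : ℕ) :
    (Finset.univ.filter fun i : Fin N => a ≤ i.val ∧ i.val < b).card ≤ b - a := by
  rw [← Nat.card_Ico]
  exact Finset.card_le_card_of_injOn Fin.val (fun i hi => by simpa using hi)
    Fin.val_injective.injOn

theorem card_sites_le {N a b n : ℕ} (h : b + 1 ≤ a + n) : (sites N a b).card ≤ n := by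
  refine (Finset.card_le_card fun i hi => ?_).trans
    ((card_filter_val_le (N := N) (a - 1) b).trans (by omega))
  simp only [sites, Finset.mem_filter, Finset.mem_univ, true_and] at hi ⊢
  omega

namespace IsConstituent

variable {N n k r : ℕ} {ξ q : ℝ} {V : Op N}

theorem mem_unitary (h : IsConstituent ξ q n k V) : V ∈ unitary (Op N) := by
  obtain ⟨h | ⟨-, A, B, hA, -, hB, -, rfl⟩, -⟩ := h
  · exact h.2.1
  · exact mul_mem hA hB

theorem norm_one_sub_le (h : IsConstituent ξ q (n + 1) k V) :
    ‖1 - V‖ ≤ √q * Real.exp (-1 / (2 * ξ)) ^ n := by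
  have hexp : Real.exp (-((n + 1 : ℕ) - 1) / ξ) = (Real.exp (-1 / (2 * ξ)) ^ n) ^ 2 := by
    rw [← Real.exp_nat_mul, ← Real.exp_nat_mul]
    congr 1
    push_cast
    ring
  have hsq := (Real.le_sqrt_of_sq_le h.2.le)
  rwa [hexp, Real.sqrt_mul' _ (sq_nonneg _), Real.sqrt_sq (by positivity)] at hsq

theorem hasCircuitUpToPhase {C δ : ℝ} (hC : IsOneQubitCost 1 C) (hk : k ≤ N)
    (h : IsConstituent ξ q (n + 1) k V) (hn : n < r) (hδ : 0 < δ) (hδ1 : δ ≤ 1) :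
    HasCircuitUpToPhase δ (2 * (130 * (C + N) * (4 * 4 ^ r) ^ 6 / (δ / 2) ^ 3)) V := by
  have hC0 := hC.1
  set L : ℝ := 130 * (C + N) * (4 * 4 ^ r) ^ 6 / (δ / 2) ^ 3
  have hL0 : 0 ≤ L := by positivity
  have hlocal : ∀ {S : Finset (Fin N)}, S.card ≤ r → ∀ {W : Op N}, W ∈ unitary (Op N) →
      ActsOn S W → HasCircuitUpToPhase (δ / 2) L W := fun hS W hW hSW =>
    (hC.hasCircuitUpToPhase_of_actsOn hW hSW (by linarith) (by linarith)).mono le_rfl (by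
      simp only [L]
      gcongr
      norm_num)
  obtain ⟨⟨-, hV, hS⟩ | ⟨hlt, A, B, hA, hAS, hB, hBS, rfl⟩, -⟩ := h
  · exact (hlocal (card_sites_le (by omega)) hV hS).mono (by linarith) (by linarith)
  · exact ((hlocal (card_sites_le (by omega)) hA hAS).mul
      (hlocal (card_sites_le (by omega)) hB hBS) hB).mono (by linarith) (by linarith)

/-- Constituents on more than `r` sites are so close to `𝟙` that the empty circuit will do. -/
theorem hasCircuitUpToPhase_of_cutoff {C δ : ℝ} (hC : IsOneQubitCost 1 C) (hk : k ≤ N)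
    (h : IsConstituent ξ q (n + 1) k V) (hr : √q * Real.exp (-1 / (2 * ξ)) ^ r ≤ δ) (hξ : 0 < ξ)
    (hδ : 0 < δ) (hδ1 : δ ≤ 1) :
    HasCircuitUpToPhase δ (2 * (130 * (C + N) * (4 * 4 ^ r) ^ 6 / (δ / 2) ^ 3)) V := by
  rcases Nat.lt_or_ge n r with hn | hn
  · exact h.hasCircuitUpToPhase hC hk hn hδ hδ1
  · have hC0 := hC.1
    have hclose : ‖1 - V‖ ≤ δ := by
      refine h.norm_one_sub_le.trans (le_trans ?_ hr)
      gcongr ?_ * ?_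
      refine pow_le_pow_of_le_one (by positivity) (Real.exp_le_one_iff.2 ?_) hn
      exact div_nonpos_of_nonpos_of_nonneg (by norm_num) (by positivity)
    exact (HasCircuitUpToPhase.one.of_norm_sub_le hclose).mono (by simp) (by positivity)

end IsConstituent

variable {N : ℕ} {ξ q : ℝ} {U : Op N}

theorem length_factors_le (V : ℕ → ℕ → Op N) : (factors V).length ≤ N ^ 2 := by
  have hlayer : ∀ n ∈ List.range' 1 N,
      ((List.range' 1 n).map fun _ => (N - n) / n + 1).sum ≤ N := by
    intro n hn
    rw [List.mem_range'_1] at hn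
    have := Nat.mul_div_le (N - n) n
    simp only [List.map_const', List.sum_replicate, List.length_range', smul_eq_mul, mul_add,
      mul_one]
    omega
  have hsum := List.sum_le_card_nsmul
    ((List.range' 1 N).map fun n => ((List.range' 1 n).map fun _ => (N - n) / n + 1).sum) N
    (List.forall_mem_map.2 hlayer)
  simpa [factors, List.length_flatMap, sq] using hsum

theorem exists_isConstituent_of_mem_factors {V : ℕ → ℕ → Op N}
    (hV : ∀ n j i : ℕ, 1 ≤ n → n ≤ N → 1 ≤ j → j ≤ n → i ≤ (N - n) / n →
      IsConstituent ξ q n (i * n + j) (V n (i * n + j))) {W : Op N} (hW : W ∈ factors V) :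
    ∃ n k, k ≤ N ∧ IsConstituent ξ q (n + 1) k W := by
  simp only [factors, List.mem_flatMap, List.mem_map, List.mem_range'_1, List.mem_range] at hW
  obtain ⟨n, hn, j, hj, i, hi, rfl⟩ := hW
  have hk : i * n ≤ N - n :=
    (Nat.mul_le_mul_right _ (Nat.lt_succ_iff.1 hi)).trans (Nat.div_mul_le_self _ _)
  refine ⟨n - 1, i * n + j, by omega, ?_⟩
  rw [Nat.sub_add_cancel hn.1]
  exact hV n j i hn.1 (by omega) hj.1 (by omega) (by omega)

namespace IsQuasilocal

theorem exists_list (hU : IsQuasilocal ξ q U) :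
    ∃ l : List (Op N), l.length ≤ N ^ 2 ∧
      (∀ W ∈ l, ∃ n k, k ≤ N ∧ IsConstituent ξ q (n + 1) k W) ∧ U = l.prod := by
  obtain ⟨V, hV, hUV | hUV⟩ := hU
  · exact ⟨_, length_factors_le V, fun W => exists_isConstituent_of_mem_factors hV, hUV⟩
  · exact ⟨_, List.length_reverse.trans_le (length_factors_le V),
      fun W hW => exists_isConstituent_of_mem_factors hV (List.mem_reverse.1 hW), hUV⟩

theorem mem_unitary (hU : IsQuasilocal ξ q U) : U ∈ unitary (Op N) := by
  obtain ⟨l, -, hl, rfl⟩ := hU.exists_list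
  refine Submonoid.list_prod_mem _ fun W hW => ?_
  obtain ⟨n, k, -, h⟩ := hl W hW
  exact h.mem_unitary

theorem hasCircuitUpToPhase_of_cutoff {C δ : ℝ} (hC : IsOneQubitCost 1 C) {r : ℕ}
    (hU : IsQuasilocal ξ q U) (hr : √q * Real.exp (-1 / (2 * ξ)) ^ r ≤ δ) (hξ : 0 < ξ)
    (hδ : 0 < δ) (hδ1 : δ ≤ 1) :
    HasCircuitUpToPhase (N ^ 2 * δ)
      (N ^ 2 * (2 * (130 * (C + N) * (4 * 4 ^ r) ^ 6 / (δ / 2) ^ 3))) U := by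
  have hC0 := hC.1
  obtain ⟨l, hlen, hl, rfl⟩ := hU.exists_list
  have hlen' : (l.length : ℝ) ≤ N ^ 2 := by exact_mod_cast hlen
  refine (HasCircuitUpToPhase.list_prod l (fun W hW => ?_) fun W hW => ?_).mono
    (mul_le_mul_of_nonneg_right hlen' hδ.le)
    (mul_le_mul_of_nonneg_right hlen' (by positivity)) <;> obtain ⟨n, k, hk, h⟩ := hl W hW
  · exact h.hasCircuitUpToPhase_of_cutoff hC hk hr hξ hδ hδ1
  · exact h.mem_unitary

end IsQuasilocal

theorem exists_hasCircuitUpToPhase_of_isQuasilocal (hξ : 0 < ξ) (q : ℝ) {δ : ℝ} (hδ : 0 < δ)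
    (hδ1 : δ ≤ 1) :
    ∃ (K : ℝ) (d : ℕ), 0 ≤ K ∧ ∀ N : ℕ, 1 ≤ N → ∀ U : Op N, IsQuasilocal ξ q U →
      HasCircuitUpToPhase δ (K * N ^ d) U := by
  obtain ⟨C, hC⟩ := exists_isOneQubitCost one_pos
  have hC0 := hC.1
  set b := Real.exp (1 / (2 * ξ))
  set e := ⌈Real.logb b 4⌉₊
  set x := (√q + 1) / δ
  have hx1 : 1 ≤ x := (one_le_div hδ).2 (by linarith [Real.sqrt_nonneg q])
  refine ⟨2 * 130 * (C + 1) * (16 * x ^ e) ^ 6 * 8 / δ ^ 3, 12 * e + 9, by positivity,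
    fun N hN U hU => ?_⟩
  have hN1 : (1 : ℝ) ≤ N := by exact_mod_cast hN
  have hN2 : (1 : ℝ) ≤ N ^ 2 := one_le_pow₀ hN1
  have hX1 : 1 ≤ x * N ^ 2 := one_le_mul_of_one_le_of_one_le hx1 hN2
  obtain ⟨r, hr, h4r⟩ := exists_pow_le_rpow_logb (g := 4)
    (Real.one_lt_exp_iff.2 (by positivity : 0 < 1 / (2 * ξ))) (by norm_num) hX1
  have hcutoff : √q * Real.exp (-1 / (2 * ξ)) ^ r ≤ δ / N ^ 2 := by
    rw [neg_div, Real.exp_neg, inv_pow, ← div_eq_mul_inv]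
    calc √q / b ^ r ≤ (√q + 1) / (x * N ^ 2) := by
          gcongr
          linarith
      _ = δ / N ^ 2 := by
          simp only [x]
          field_simp
  have hpow : (4 : ℝ) ^ r ≤ 4 * (x * N ^ 2) ^ e :=
    h4r.trans (by
      rw [← Real.rpow_natCast _ e]
      gcongr
      exact Nat.le_ceil _)
  refine (hU.hasCircuitUpToPhase_of_cutoff hC hcutoff hξ (by positivity)
    ((div_le_one (by positivity)).2 (hδ1.trans hN2))).mono (by field_simp; rfl) ?_
  calc N ^ 2 * (2 * (130 * (C + N) * (4 * 4 ^ r) ^ 6 / (δ / N ^ 2 / 2) ^ 3))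
      ≤ N ^ 2 * (2 * (130 * (C * N + N) * (4 * (4 * (x * N ^ 2) ^ e)) ^ 6 /
          (δ / N ^ 2 / 2) ^ 3)) := by
        gcongr
        exact le_mul_of_one_le_right hC0.le hN1
    _ = 2 * 130 * (C + 1) * (16 * x ^ e) ^ 6 * 8 / δ ^ 3 * N ^ (12 * e + 9) := by
        rw [mul_pow x, ← pow_mul (N : ℝ), pow_add (N : ℝ), mul_assoc, mul_comm 12 e]
        simp only [mul_pow, ← pow_mul, div_pow]
        field_simp
        ring_nf

end Quasilocal

section Evolution

variable {N : ℕ}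

theorem prod_map_sigmaZ (l : List (Fin N)) : (l.map sigmaZ).prod =
    Matrix.diagonal fun x => (((l.map fun i => spin (x i)).prod : ℝ) : ℂ) := by
  induction l with
  | nil => simp
  | cons i l ih =>
    rw [List.map_cons, List.prod_cons, ih, sigmaZ, Matrix.diagonal_mul_diagonal]
    congr 1
    ext x
    by_cases h : x i = 0 <;> simp [spin, h]

theorem prod_map_tauZ {U : Op N} (hU : U ∈ unitary (Op N)) (l : List (Fin N)) :
    (l.map (tauZ U)).prod = U * (l.map sigmaZ).prod * star U := by
  induction l with
  | nil => simp [Unitary.mul_star_self_of_mem hU]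
  | cons i l ih =>
    rw [List.map_cons, List.prod_cons, ih, List.map_cons, List.prod_cons, tauZ,
      ← Matrix.star_eq_conjTranspose]
    calc U * sigmaZ i * star U * (U * (l.map sigmaZ).prod * star U)
        = U * sigmaZ i * (star U * U) * (l.map sigmaZ).prod * star U := by noncomm_ring
      _ = U * (sigmaZ i * (l.map sigmaZ).prod) * star U := by
          rw [Unitary.star_mul_self_of_mem hU, mul_one, mul_assoc U]

theorem tauProd_eq {U : Op N} (hU : U ∈ unitary (Op N)) (I : Finset (Fin N)) :
    tauProd U I = U * Matrix.diagonal (fun x => ((parity I x : ℝ) : ℂ)) * star U := by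
  have hparity : ∀ x : Basis N,
      ((I.sort (· ≤ ·)).map fun i => spin (x i)).prod = parity I x := fun x => by
    rw [parity, Finset.prod_eq_multiset_prod, ← Finset.sort_eq I (· ≤ ·), Multiset.map_coe,
      Multiset.prod_coe]
  simp only [tauProd, prod_map_tauZ hU, prod_map_sigmaZ, hparity]

/-- The unitary `exp (-it ∑_{I ∈ F} J_I ∏_{i ∈ I} σᶻ_i)`: the evolution under an MBL Hamiltonian
in the eigenbasis of its local integrals of motion. -/
noncomputable def diagEvolution (F : Finset (Finset (Fin N))) (J : Finset (Fin N) → ℝ) (t : ℝ) :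
    Op N :=
  Matrix.diagonal fun x => Complex.exp ((∑ I ∈ F, -t * J I * parity I x : ℝ) * Complex.I)

variable (F : Finset (Finset (Fin N))) (J : Finset (Fin N) → ℝ)

theorem diagEvolution_mem_unitary (t : ℝ) : diagEvolution F J t ∈ unitary (Op N) :=
  diagonal_exp_mem_unitary _

theorem sum_smul_tauProd_eq {U : Op N} (hU : U ∈ unitary (Op N)) :
    ∑ I ∈ F, (J I : ℂ) • tauProd U I =
      U * Matrix.diagonal (fun x => ((∑ I ∈ F, J I * parity I x : ℝ) : ℂ)) * star U := by
  have hsum : Matrix.diagonal (fun x => ((∑ I ∈ F, J I * parity I x : ℝ) : ℂ)) =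
      ∑ I ∈ F, (J I : ℂ) • Matrix.diagonal (fun x : Basis N => ((parity I x : ℝ) : ℂ)) := by
    ext x y
    rw [Matrix.sum_apply]
    rcases eq_or_ne x y with rfl | hxy
    · simp
    · simp [hxy]
  simp only [hsum, Finset.mul_sum, Finset.sum_mul, tauProd_eq hU, mul_smul_comm, smul_mul_assoc]

theorem evolution_sum_smul_tauProd {U : Op N} (hU : U ∈ unitary (Op N)) (t : ℝ) :
    evolution (∑ I ∈ F, (J I : ℂ) • tauProd U I) t = U * diagEvolution F J t * star U := by
  rw [evolution, sum_smul_tauProd_eq F J hU, ← smul_mul_assoc, ← mul_smul_comm,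
    exp_unitary_conj hU, ← Matrix.diagonal_smul, Matrix.exp_diagonal, diagEvolution]
  congr 3
  ext x
  rw [Pi.coe_exp, ← Complex.exp_eq_exp_ℂ, Pi.smul_apply, smul_eq_mul]
  simp only [mul_assoc, ← Finset.mul_sum]
  push_cast
  ring_nf

theorem norm_exp_ofReal_mul_I_sub_le (a b : ℝ) :
    ‖Complex.exp (a * Complex.I) - Complex.exp (b * Complex.I)‖ ≤ |a - b| := by
  have hfactor : Complex.exp (a * Complex.I) - Complex.exp (b * Complex.I) =
      Complex.exp (b * Complex.I) * (Complex.exp (Complex.I * ((a - b : ℝ) : ℂ)) - 1) := by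
    rw [mul_sub, ← Complex.exp_add, mul_one]
    congr 2
    push_cast
    ring
  rw [hfactor, norm_mul, Complex.norm_exp_ofReal_mul_I, one_mul]
  exact Real.norm_exp_I_mul_ofReal_sub_one_le

variable {F}

theorem norm_diagEvolution_sub_le {F' : Finset (Finset (Fin N))} (hF : F' ⊆ F) {t : ℝ}
    (ht : 0 ≤ t) : ‖diagEvolution F' J t - diagEvolution F J t‖ ≤ t * ∑ I ∈ F \ F', |J I| := by
  rw [diagEvolution, diagEvolution, Matrix.diagonal_sub, Matrix.l2_opNorm_diagonal]
  refine (pi_norm_le_iff_of_nonneg (by positivity)).2 fun x =>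
    (norm_exp_ofReal_mul_I_sub_le _ _).trans ?_
  rw [← Finset.sum_sdiff hF, sub_add_cancel_right, abs_neg, Finset.mul_sum]
  refine (Finset.abs_sum_le_sum_abs _ _).trans_eq (Finset.sum_congr rfl fun I _ => ?_)
  rw [abs_mul, abs_parity, mul_one, abs_mul, abs_neg, abs_of_nonneg ht]

variable (F)

theorem diagEvolution_eq_prod (t : ℝ) :
    diagEvolution F J t = (F.toList.map fun I => zRot I (-t * J I)).prod := by
  have hlist : ∀ l : List (Finset (Fin N)), (l.map fun I => zRot I (-t * J I)).prod =
      Matrix.diagonal fun x =>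
        Complex.exp (((l.map fun I => -t * J I * parity I x).sum : ℝ) * Complex.I) := by
    intro l
    induction l with
    | nil => simp
    | cons I l ih =>
      rw [List.map_cons, List.prod_cons, ih, zRot, Matrix.diagonal_mul_diagonal]
      congr 1
      ext x
      rw [← Complex.exp_add, List.map_cons, List.sum_cons, Complex.ofReal_add, add_mul]
  rw [hlist, diagEvolution]
  simp only [Finset.sum_map_toList]

variable {F}

theorem IsOneQubitCost.hasCircuit_diagEvolution {s C : ℝ} (hC : IsOneQubitCost s C)
    (hs0 : 0 ≤ s) (hs1 : s ≤ 1) (hF : ∀ I ∈ F, I.Nonempty) {M : ℝ} (hM : 1 ≤ M)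
    (hFM : F.card ≤ M) {δ : ℝ} (hδ : 0 < δ) (hδ1 : δ ≤ 1) (t : ℝ) :
    HasCircuit δ ((C / δ + 2 * N) * M ^ (1 + s)) (diagEvolution F J t) := by
  have hC0 := hC.1
  have hδM : δ / M ≤ 1 := div_le_one_of_le₀ (hδ1.trans hM) (by positivity)
  have hprod := HasCircuit.list_prod (δ := δ / M) (L := C * (δ / M) ^ (-s) + 2 * N)
    (F.toList.map fun I => zRot I (-t * J I))
    (List.forall_mem_map.2 fun I hI =>
      (hC.hasCircuit_zRot (hF I (Finset.mem_toList.1 hI)) (by positivity) hδM _).mono le_rfl (by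
        gcongr
        exact (Finset.card_le_univ I).trans_eq (Fintype.card_fin N)))
    (List.forall_mem_map.2 fun I _ => zRot_mem_unitary I _)
  rw [← diagEvolution_eq_prod, List.length_map, Finset.length_toList] at hprod
  have hcost : C * (δ / M) ^ (-s) + 2 * N ≤ (C / δ + 2 * N) * M ^ s := by
    have hδs : δ ^ (-s) ≤ δ⁻¹ := by
      rw [← Real.rpow_neg_one]
      exact Real.rpow_le_rpow_of_exponent_ge hδ hδ1 (by linarith)
    calc C * (δ / M) ^ (-s) + 2 * N = C * (δ ^ (-s) * M ^ s) + 2 * N * 1 := by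
          rw [Real.div_rpow hδ.le (by positivity), Real.rpow_neg (by positivity : 0 ≤ M),
            div_inv_eq_mul, mul_one]
      _ ≤ C * (δ⁻¹ * M ^ s) + 2 * N * M ^ s := by
          gcongr
          exact Real.one_le_rpow hM hs0
      _ = (C / δ + 2 * N) * M ^ s := by ring
  refine hprod.mono ((mul_le_mul_of_nonneg_right hFM (by positivity)).trans_eq (by field_simp)) ?_
  calc F.card * (C * (δ / M) ^ (-s) + 2 * N) ≤ M * ((C / δ + 2 * N) * M ^ s) := by gcongr
    _ = (C / δ + 2 * N) * M ^ (1 + s) := by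
        rw [Real.rpow_add (by positivity), Real.rpow_one]
        ring

end Evolution

section Truncation

variable {N : ℕ}

/-- The distance `i_p - i_1` between the extreme sites of `I = {i_1 < ⋯ < i_p}`. -/
def width (I : Finset (Fin N)) : ℕ :=
  if h : I.Nonempty then (I.max' h).val - (I.min' h).val else 0

/-- The sets of sites that lie in a window of `s` consecutive sites of the chain. -/
def windowSets (N s : ℕ) : Finset (Finset (Fin N)) :=
  Finset.univ.biUnion fun a : Fin N =>
    (Finset.univ.filter fun i : Fin N => a.val ≤ i.val ∧ i.val < a.val + s).powerset

theorem card_windowSets_le (N s : ℕ) : (windowSets N s).card ≤ N * 2 ^ s := by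
  refine (Finset.card_biUnion_le_card_mul _ _ (2 ^ s) fun a _ => ?_).trans (by simp)
  rw [Finset.card_powerset]
  exact Nat.pow_le_pow_right two_pos ((card_filter_val_le _ _).trans_eq (by omega))

theorem mem_windowSets {I : Finset (Fin N)} (hI : I.Nonempty) {s : ℕ} (h : width I < s) :
    I ∈ windowSets N s := by
  rw [width, dif_pos hI] at h
  simp only [windowSets, Finset.mem_biUnion, Finset.mem_univ, true_and, Finset.mem_powerset]
  refine ⟨I.min' hI, fun i hi => ?_⟩
  have hmin : (I.min' hI).val ≤ i.val := I.min'_le i hi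
  have hmax : i.val ≤ (I.max' hI).val := I.le_max' i hi
  simp only [Finset.mem_filter, Finset.mem_univ, true_and]
  omega

theorem width_lt {I : Finset (Fin N)} (hI : I.Nonempty) : width I < N := by
  rw [width, dif_pos hI]
  have := (I.max' hI).isLt
  omega

theorem exp_neg_div_eq_pow_width {I : Finset (Fin N)} (hI : I.Nonempty) (ξ : ℝ) :
    Real.exp (-(((I.max' hI).val : ℝ) - ((I.min' hI).val : ℝ)) / ξ) =
      Real.exp (-1 / ξ) ^ width I := by
  rw [width, dif_pos hI, ← Real.exp_nat_mul, Nat.cast_sub (I.min'_le_max' hI)]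
  ring_nf

variable {F : Finset (Finset (Fin N))}

theorem card_le_of_forall_width_lt (hF : ∀ I ∈ F, I.Nonempty) {s : ℕ}
    (hs : ∀ I ∈ F, width I < s) : F.card ≤ N * 2 ^ s :=
  (Finset.card_le_card fun I hI => mem_windowSets (hF I hI) (hs I hI)).trans
    (card_windowSets_le N s)

theorem sum_pow_width_le {y : ℝ} (hy : 0 ≤ y) (hy1 : 2 * y < 1) (hF : ∀ I ∈ F, I.Nonempty) {r : ℕ}
    (hr : ∀ I ∈ F, r ≤ width I) :
    ∑ I ∈ F, y ^ width I ≤ 2 * N * ((2 * y) ^ r / (1 - 2 * y)) := by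
  have hfiber : ∀ s, ∑ I ∈ F with width I = s, y ^ width I ≤ 2 * N * (2 * y) ^ s := fun s => by
    have hcard : (F.filter fun I => width I = s).card ≤ N * 2 ^ (s + 1) :=
      card_le_of_forall_width_lt (fun I hI => hF I (Finset.mem_filter.1 hI).1)
        fun I hI => ((Finset.mem_filter.1 hI).2).trans_lt s.lt_succ_self
    calc ∑ I ∈ F with width I = s, y ^ width I
        = (F.filter fun I => width I = s).card * y ^ s := by
          rw [← nsmul_eq_mul, ← Finset.sum_const]
          exact Finset.sum_congr rfl fun I hI => by rw [(Finset.mem_filter.1 hI).2]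
      _ ≤ (N * 2 ^ (s + 1)) * y ^ s := by
          gcongr
          exact_mod_cast hcard
      _ = 2 * N * (2 * y) ^ s := by ring
  calc ∑ I ∈ F, y ^ width I
      = ∑ s ∈ Finset.Ico r N, ∑ I ∈ F with width I = s, y ^ width I :=
        (Finset.sum_fiberwise_of_maps_to (fun I hI =>
          Finset.mem_Ico.2 ⟨hr I hI, width_lt (hF I hI)⟩) _).symm
    _ ≤ ∑ s ∈ Finset.Ico r N, 2 * N * (2 * y) ^ s := Finset.sum_le_sum fun s _ => hfiber s
    _ ≤ 2 * N * ((2 * y) ^ r / (1 - 2 * y)) := by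
        rw [← Finset.mul_sum]
        gcongr
        exact geom_sum_Ico_le_of_lt_one (by positivity) hy1

variable {J : Finset (Fin N) → ℝ}

theorem norm_diagEvolution_filter_width_lt_sub_le {y : ℝ} (hy : 0 ≤ y) (hy1 : 2 * y < 1)
    (hF : ∀ I ∈ F, I.Nonempty) (hJ : ∀ I ∈ F, |J I| ≤ y ^ width I) {t : ℝ} (ht : 0 ≤ t) (r : ℕ) :
    ‖diagEvolution (F.filter fun I => width I < r) J t - diagEvolution F J t‖ ≤
      t * (2 * N * ((2 * y) ^ r / (1 - 2 * y))) := by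
  refine (norm_diagEvolution_sub_le J (Finset.filter_subset _ _) ht).trans ?_
  rw [← Finset.filter_not]
  gcongr
  refine (Finset.sum_le_sum fun I hI => hJ I (Finset.mem_filter.1 hI).1).trans
    (sum_pow_width_le hy hy1 (fun I hI => hF I (Finset.mem_filter.1 hI).1) fun I hI =>
      not_lt.1 (Finset.mem_filter.1 hI).2)

theorem IsOneQubitCost.hasCircuit_diagEvolution_of_truncation {s C : ℝ} (hC : IsOneQubitCost s C)
    (hs0 : 0 ≤ s) (hs1 : s ≤ 1) (hN : 1 ≤ N) {y : ℝ} (hy : 0 ≤ y) (hy1 : 2 * y < 1)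
    (hF : ∀ I ∈ F, I.Nonempty) (hJ : ∀ I ∈ F, |J I| ≤ y ^ width I) {δ t : ℝ} (hδ : 0 < δ)
    (hδ1 : δ ≤ 1) (ht : 0 ≤ t) {r : ℕ} (hr : t * (2 * N * ((2 * y) ^ r / (1 - 2 * y))) ≤ δ / 2) :
    HasCircuit δ ((C / (δ / 2) + 2 * N) * (N * 2 ^ r) ^ (1 + s)) (diagEvolution F J t) := by
  have hcard : (F.filter fun I => width I < r).card ≤ N * 2 ^ r :=
    card_le_of_forall_width_lt (fun I hI => hF I (Finset.mem_filter.1 hI).1)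
      fun I hI => (Finset.mem_filter.1 hI).2
  have hM : 1 ≤ N * 2 ^ r := Nat.one_le_iff_ne_zero.2 (by positivity)
  refine ((hC.hasCircuit_diagEvolution J hs0 hs1 (fun I hI => hF I (Finset.mem_filter.1 hI).1)
    (M := N * 2 ^ r) (by exact_mod_cast hM) (by exact_mod_cast hcard) (half_pos hδ)
    (by linarith) t).of_norm_sub_le
    ((norm_diagEvolution_filter_width_lt_sub_le hy hy1 hF hJ ht r).trans hr)).mono
    (add_halves δ).le le_rfl

theorem exists_truncation {y δ T : ℝ} (hy : 0 < y) (hy1 : 2 * y < 1) (hδ : 0 < δ) (hT : 0 < T) :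
    ∃ r : ℕ, T * (2 * ((2 * y) ^ r / (1 - 2 * y))) ≤ δ / 2 ∧
      2 ^ r ≤ 2 * (1 + 4 / (δ * (1 - 2 * y)) * T) ^ Real.logb (2 * y)⁻¹ 2 := by
  have hy2 : 0 < 1 - 2 * y := by linarith
  obtain ⟨r, hr, h2r⟩ := exists_pow_le_rpow_logb ((one_lt_inv₀ (by positivity)).2 hy1) one_le_two
    (le_add_of_nonneg_right (by positivity) : 1 ≤ 1 + 4 / (δ * (1 - 2 * y)) * T)
  have hle : 4 / (δ * (1 - 2 * y)) * T ≤ (2 * y)⁻¹ ^ r := by linarith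
  rw [inv_pow, le_inv_comm₀ (by positivity) (by positivity)] at hle
  refine ⟨r, ?_, h2r⟩
  calc T * (2 * ((2 * y) ^ r / (1 - 2 * y)))
      ≤ T * (2 * ((4 / (δ * (1 - 2 * y)) * T)⁻¹ / (1 - 2 * y))) := by gcongr
    _ = δ / 2 := by
        field_simp
        norm_num

theorem rpow_one_add_le {A n t R α s : ℝ} (hA : 0 ≤ A) (hn : 1 ≤ n) (ht : 0 ≤ t) (hR0 : 0 ≤ R)
    (hα : 0 ≤ α) (hs0 : 0 ≤ s) (hs1 : s ≤ 1) (ha : α * (1 + s) ≤ 1)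
    (hR : R ≤ 2 * (1 + A * (n * t)) ^ α) :
    (n * R) ^ (1 + s) ≤ 4 * (1 + A) * n ^ 3 * (1 + t) ^ (α * (1 + s)) := by
  have hbase : 1 + A * (n * t) ≤ (1 + A) * n * (1 + t) := by
    linarith [mul_nonneg hA (zero_le_one.trans hn), mul_nonneg (zero_le_one.trans hn) ht]
  calc (n * R) ^ (1 + s) ≤ (n * (2 * (1 + A * (n * t)) ^ α)) ^ (1 + s) := by gcongr
    _ = (2 * n) ^ (1 + s) * (1 + A * (n * t)) ^ (α * (1 + s)) := by
        rw [Real.rpow_mul (by positivity), ← Real.mul_rpow (by positivity) (by positivity)]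
        ring_nf
    _ ≤ (2 * n) ^ (2 : ℝ) * ((1 + A) * n * (1 + t)) ^ (α * (1 + s)) := by
        gcongr <;> linarith
    _ ≤ (2 * n) ^ (2 : ℝ) * ((1 + A) * n * (1 + t) ^ (α * (1 + s))) := by
        rw [Real.mul_rpow (x := (1 + A) * n) (by positivity) (by positivity)]
        gcongr
        exact Real.rpow_le_self_of_one_le
          (one_le_mul_of_one_le_of_one_le (le_add_of_nonneg_right hA) hn) ha
    _ = 4 * (1 + A) * n ^ 3 * (1 + t) ^ (α * (1 + s)) := by
        rw [Real.rpow_two]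
        ring

theorem exists_hasCircuit_diagEvolution {y δ : ℝ} (hy : 0 < y) (hy4 : 4 * y < 1) (hδ : 0 < δ)
    (hδ1 : δ ≤ 1) :
    ∃ K a : ℝ, 0 ≤ K ∧ 0 ≤ a ∧ a < 1 ∧ ∀ N : ℕ, 1 ≤ N → ∀ F : Finset (Finset (Fin N)),
      (∀ I ∈ F, I.Nonempty) → ∀ J : Finset (Fin N) → ℝ, (∀ I ∈ F, |J I| ≤ y ^ width I) →
      ∀ t : ℝ, 0 < t → HasCircuit δ (K * N ^ 4 * (1 + t) ^ a) (diagEvolution F J t) := by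
  have hb : 2 < (2 * y)⁻¹ := (lt_inv_comm₀ two_pos (by positivity)).2 (by linarith)
  set α : ℝ := Real.logb (2 * y)⁻¹ 2
  have hα0 : 0 ≤ α := Real.logb_nonneg (by linarith) one_le_two
  have hα1 : α < 1 := (Real.logb_lt_iff_lt_rpow (by linarith) two_pos).2 (by rwa [Real.rpow_one])
  obtain ⟨s, hs⟩ : ∃ s, s = (1 - α) / 2 := ⟨_, rfl⟩
  have hs0 : 0 < s := by linarith
  have hs1 : s ≤ 1 := by linarith
  have ha1 : α * (1 + s) < 1 := by rw [hs]; nlinarith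
  obtain ⟨C, hC⟩ := exists_isOneQubitCost hs0
  have hC0 := hC.1
  set A : ℝ := 4 / (δ * (1 - 2 * y))
  have hA0 : 0 ≤ A := div_nonneg (by norm_num) (mul_nonneg hδ.le (by linarith))
  refine ⟨(C / (δ / 2) + 2) * (4 * (1 + A)), α * (1 + s), by positivity, by positivity, ha1,
    fun N hN F hF J hJ t ht => ?_⟩
  have hN1 : (1 : ℝ) ≤ N := by exact_mod_cast hN
  obtain ⟨r, htail, h2r⟩ := exists_truncation hy (by linarith) hδ (by positivity : 0 < N * t)
  refine (hC.hasCircuit_diagEvolution_of_truncation hs0.le hs1 hN hy.le (by linarith) hF hJ hδ hδ1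
    ht.le (r := r) (le_of_eq_of_le (by ring) htail)).mono le_rfl ?_
  calc (C / (δ / 2) + 2 * N) * (N * 2 ^ r) ^ (1 + s)
      ≤ (C / (δ / 2) * N + 2 * N) *
          (4 * (1 + A) * N ^ 3 * (1 + t) ^ (α * (1 + s))) := by
        gcongr
        · exact le_mul_of_one_le_right (by positivity) hN1
        · exact rpow_one_add_le hA0 hN1 ht.le (by positivity) hα0 hs0.le hs1 ha1.le h2r
    _ = (C / (δ / 2) + 2) * (4 * (1 + A)) * N ^ 4 * (1 + t) ^ (α * (1 + s)) := by ring

end Truncation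

section Complexity

variable {N : ℕ} {ε L : ℝ} {W : Op N}

theorem HasCircuitUpToPhase.conj {δ δ' L' : ℝ} {U D : Op N} (h : HasCircuitUpToPhase δ L U)
    (hU : U ∈ unitary (Op N)) (hD : HasCircuit δ' L' D) (hDu : D ∈ unitary (Op N)) :
    HasCircuit (δ + δ' + δ) (L + L' + 7 * L) (U * D * star U) := by
  obtain ⟨c, hc, hcU⟩ := h
  have hphase : c • U * D * star (c • U) = U * D * star U := by
    rw [star_smul, smul_mul_assoc, smul_mul_smul_comm, Unitary.mul_star_self_of_mem hc, one_smul]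
  rw [← hphase]
  exact (hcU.mul hD hDu).mul hcU.star (Unitary.star_mem (Unitary.smul_mem_of_mem hc hU))

theorem exists_hasCircuit_evolution {ξ : ℝ} (hξ0 : 0 < ξ) (hξ : ξ < 1 / (2 * Real.log 2)) (q : ℝ)
    (hε : 0 < ε) :
    ∃ (K a : ℝ) (d : ℕ), a < 1 ∧ ∀ N : ℕ, 1 ≤ N → ∀ H : Op N, IsMBL ξ q H → ∀ t : ℝ, 0 < t →
      HasCircuit ε (K * N ^ d * (1 + t) ^ a) (evolution H t) := by
  have hy : 4 * Real.exp (-1 / ξ) < 1 := by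
    have hlog : Real.log 4 < 1 / ξ := by
      rw [show (4 : ℝ) = 2 ^ 2 by norm_num, Real.log_pow, lt_one_div (by positivity) hξ0]
      exact_mod_cast hξ
    rw [neg_div, Real.exp_neg, ← div_eq_mul_inv, div_lt_one (Real.exp_pos _)]
    exact (Real.log_lt_iff_lt_exp four_pos).1 hlog
  have hδ : 0 < min ε 1 / 3 := by positivity
  have hδ1 : min ε 1 / 3 ≤ 1 := by linarith [min_le_right ε 1]
  obtain ⟨K₁, d, hK₁, hU⟩ := exists_hasCircuitUpToPhase_of_isQuasilocal hξ0 q hδ hδ1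
  obtain ⟨K₂, a, hK₂, ha0, ha1, hD⟩ := exists_hasCircuit_diagEvolution (Real.exp_pos _) hy hδ hδ1
  refine ⟨8 * K₁ + K₂, a, d + 4, ha1, ?_⟩
  rintro N hN H ⟨U, J, hUq, hJ, rfl⟩ t ht
  have hN1 : (1 : ℝ) ≤ N := by exact_mod_cast hN
  have ht1 : 1 ≤ (1 + t) ^ a := Real.one_le_rpow (by linarith) ha0
  rw [evolution_sum_smul_tauProd _ J hUq.mem_unitary]
  refine ((hU N hN U hUq).conj hUq.mem_unitary (hD N hN _ (fun I hI => (Finset.mem_filter.1 hI).2)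
    J (fun I hI => ?_) t ht) (diagEvolution_mem_unitary _ J t)).mono ?_ ?_
  · have hI := (Finset.mem_filter.1 hI).2
    exact (hJ I hI).trans_eq (exp_neg_div_eq_pow_width hI ξ)
  · linarith [min_le_left ε 1]
  · calc K₁ * N ^ d + K₂ * N ^ 4 * (1 + t) ^ a + 7 * (K₁ * N ^ d)
        = 8 * K₁ * N ^ d * 1 + K₂ * N ^ 4 * (1 + t) ^ a := by ring
      _ ≤ 8 * K₁ * N ^ (d + 4) * (1 + t) ^ a + K₂ * N ^ (d + 4) * (1 + t) ^ a := by
          gcongr <;> first | exact hN1 | omega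
      _ = (8 * K₁ + K₂) * N ^ (d + 4) * (1 + t) ^ a := by ring

theorem isLittleO_one_add_rpow {a : ℝ} (ha : a < 1) :
    (fun t : ℝ => (1 + t) ^ a) =o[Filter.atTop] fun t => t := by
  have hshift : Filter.Tendsto (fun t : ℝ => 1 + t) Filter.atTop Filter.atTop :=
    Filter.tendsto_atTop_add_const_left _ _ Filter.tendsto_id
  have hrpow : (fun t : ℝ => t ^ a) =o[Filter.atTop] fun t => t := by
    refine Asymptotics.isLittleO_of_tendsto' ?_ ?_
    · filter_upwards [Filter.eventually_gt_atTop 0] with t ht h using absurd h ht.ne'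
    · refine (tendsto_rpow_neg_atTop (sub_pos.2 ha)).congr' ?_
      filter_upwards [Filter.eventually_gt_atTop 0] with t ht
      rw [neg_sub, Real.rpow_sub_one ht.ne']
  refine (hrpow.comp_tendsto hshift).trans_isBigO (Asymptotics.IsBigO.add ?_ ?_)
  · exact (Asymptotics.isLittleO_const_id_atTop 1).isBigO
  · exact Asymptotics.isBigO_refl _ _

theorem HasCircuit.approxSizes_nonempty (h : HasCircuit ε L W) : (approxSizes ε W).Nonempty :=
  let ⟨G, _, hG⟩ := h
  ⟨_, G, rfl, hG⟩

theorem HasCircuit.circuitComplexity_le (h : HasCircuit ε L W) : circuitComplexity ε W ≤ L := by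
  obtain ⟨G, hGL, hG⟩ := h
  refine le_trans ?_ hGL
  exact_mod_cast Nat.sInf_le (⟨G, rfl, hG⟩ : G.length ∈ approxSizes ε W)

end Complexity

end MBL

theorem theorem3_general (ξ : ℝ) (hξ0 : 0 < ξ) (hξ : ξ < 1 / (2 * Real.log 2)) (q : ℝ)
    (ε : ℝ) (hε : 0 < ε) :
    ∃ (P Q : Polynomial ℝ) (g : ℝ → ℝ),
      Asymptotics.IsLittleO Filter.atTop g (fun t : ℝ => t) ∧
      (∀ N : ℕ, 1 ≤ N →
        Asymptotics.IsLittleO Filter.atTop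
          (fun t : ℝ => P.eval (N : ℝ) * Q.eval (Real.log ((N : ℝ) ^ 2 * t)) * g t)
          (fun t : ℝ => t)) ∧
      ∀ N : ℕ, 1 ≤ N → ∀ H : MBL.Op N, MBL.IsMBL ξ q H → ∀ t : ℝ, 0 < t →
        (MBL.approxSizes ε (MBL.evolution H t)).Nonempty ∧
        (MBL.circuitComplexity ε (MBL.evolution H t) : ℝ) ≤
          P.eval (N : ℝ) * Q.eval (Real.log ((N : ℝ) ^ 2 * t)) * g t := by
  obtain ⟨K, a, d, ha, hcircuit⟩ := MBL.exists_hasCircuit_evolution hξ0 hξ q hε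
  have hg := MBL.isLittleO_one_add_rpow ha
  refine ⟨Polynomial.C K * Polynomial.X ^ d, 1, fun t => (1 + t) ^ a, hg,
    fun N _ => by simpa only [Polynomial.eval_one, mul_one] using hg.const_mul_left _,
    fun N hN H hH t ht => ?_⟩
  have h := hcircuit N hN H hH t ht
  refine ⟨h.approxSizes_nonempty, h.circuitComplexity_le.trans_eq ?_⟩
  simp only [Polynomial.eval_mul, Polynomial.eval_C, Polynomial.eval_pow, Polynomial.eval_X,
    Polynomial.eval_one, mul_one]

theorem theorem3 (ξ : ℝ) (hξ0 : 0 < ξ) (hξ : ξ < 1 / (4 * Real.log 2)) (q : ℝ)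
    (ε : ℝ) (hε : 0 < ε) :
    ∃ (P Q : Polynomial ℝ) (g : ℝ → ℝ),
      Asymptotics.IsLittleO Filter.atTop g (fun t : ℝ => t) ∧
      (∀ N : ℕ, 1 ≤ N →
        Asymptotics.IsLittleO Filter.atTop
          (fun t : ℝ => P.eval (N : ℝ) * Q.eval (Real.log ((N : ℝ) ^ 2 * t)) * g t)
          (fun t : ℝ => t)) ∧
      ∀ N : ℕ, 1 ≤ N → ∀ H : MBL.Op N, MBL.IsMBL ξ q H → ∀ t : ℝ, 0 < t →
        (MBL.approxSizes ε (MBL.evolution H t)).Nonempty ∧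
        (MBL.circuitComplexity ε (MBL.evolution H t) : ℝ) ≤
          P.eval (N : ℝ) * Q.eval (Real.log ((N : ℝ) ^ 2 * t)) * g t :=
  theorem3_general ξ hξ0 (hξ.trans_le (by gcongr; norm_num)) q ε hε
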